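/- Let $\Bbbk$ be an algebraically closed field of characteristic $p>2$ and let $\mathfrak L=\mathfrak L_{\bar 0}\oplus\mathfrak L_{\bar 1}$ be a restricted Lie superalgebra over $\Bbbk$, of arbitrary dimension (if $p=3$, the axiom $[x,[x,x]]=0$ for odd $x$ is part of the definition of a Lie superalgebra). Restricted means that there is a $p$-th power map $x\mapsto x^{[p]}$ on $\mathfrak L_{\bar 0}$ which makes $\mathfrak L_{\bar 0}$ a restricted Lie algebra and satisfies $(\operatorname{ad}x)^p=\operatorname{ad}(x^{[p]})$ on all of $\mathfrak L$ for $x\in\mathfrak L_{\bar 0}$. Assume that $\mathfrak L$ is semisimple, i.e. that its only solvable graded ideal is $0$. Let $\{e_i\mid i\in I_0\}$ be a basis of $\mathfrak L_{\bar 0}$. Let $\mathfrak g$ be the current superalgebra $\mathfrak L[x]=\mathfrak L\otimes\Bbbk[x]$, with $\mathbb I=\mathbb N$ (including $0$), or the loop superalgebra $\mathfrak L(x)=\mathfrak L\otimes\Bbbk[x,x^{-1}]$, with $\mathbb I=\mathbb Z$. In both cases the bracket is $[e\otimes x^r,f\otimes x^s]=[e,f]\otimes x^{r+s}$ and the grading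 is $|e\otimes x^r|=|e|$. Write $e_{ir}=e_i\otimes x^r$ and $e_{ir}^{[p]}=e_i^{[p]}\otimes x^{rp}$. Let $U(\mathfrak g)$ be the universal enveloping superalgebra of $\mathfrak g$ and let $$Z(\mathfrak g)=\{z\in U(\mathfrak g)\mid [z,u]=0\ \text{for all }u\in U(\mathfrak g)\}$$ be its center, where $[z,u]=zu-(-1)^{|z||u|}uz$ for homogeneous $z,u$, extended bilinearly. Then $Z(\mathfrak g)$ is freely generated, as a commutative algebra, by $$\{\,e_{ir}^p-e_{ir}^{[p]}\mid i\in I_0,\ r\in\mathbb I\,\}:$$ these elements commute with one another, are algebraically independent over $\Bbbk$, and the subalgebra that they generate is $Z(\mathfrak g)$. -/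

import Mathlib

open scoped TensorProduct Polynomial LaurentPolynomial

/-- A Lie superalgebra structure on the `k`-vector space `L`, for a field `k` of characteristic
different from two: a `ℤ/2`-grading `L = L₀ ⊕ L₁` and an even bilinear bracket which is super
skew-symmetric and satisfies the super Jacobi identity. The last field follows from the Jacobi
identity when `3` is invertible; it is the customary extra axiom in characteristic three. -/
structure LieSuperalgebra (k : Type*) (L : Type*) [Field k] [AddCommGroup L] [Module k L] where
  /-- `part 0` is the even part and `part 1` the odd part. -/
  part : ZMod 2 → Submodule k L
  isCompl : IsCompl (part 0) (part 1)
  bracket : L →ₗ[k] L →ₗ[k] L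
  bracket_mem : ∀ (i j : ZMod 2) (x y : L), x ∈ part i → y ∈ part j →
    bracket x y ∈ part (i + j)
  skew : ∀ (i j : ZMod 2) (x y : L), x ∈ part i → y ∈ part j →
    bracket x y = -((-1 : k) ^ (i.val * j.val) • bracket y x)
  jacobi : ∀ (i j : ZMod 2) (x y z : L), x ∈ part i → y ∈ part j →
    bracket x (bracket y z) =
      bracket (bracket x y) z + (-1 : k) ^ (i.val * j.val) • bracket y (bracket x z)
  odd_cube : ∀ x : L, x ∈ part 1 → bracket x (bracket x x) = 0

namespace LieSuperalgebra

variable {k : Type*} {L : Type*} [Field k] [AddCommGroup L] [Module k L]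

section Semisimple

/-- A graded (two-sided) ideal: a graded subspace stable under bracketing with `L`. -/
def IsIdeal (S : LieSuperalgebra k L) (N : Submodule k L) : Prop :=
  N = (N ⊓ S.part 0) ⊔ (N ⊓ S.part 1) ∧ ∀ x y : L, y ∈ N → S.bracket x y ∈ N

/-- The derived series of a subspace: `D⁰ = N` and `Dⁿ⁺¹ = [Dⁿ, Dⁿ]`, the linear span of all
brackets of two elements of `Dⁿ`. -/
def derived (S : LieSuperalgebra k L) (N : Submodule k L) : ℕ → Submodule k L
  | 0 => N
  | n + 1 => Submodule.span k
      {z : L | ∃ x ∈ derived S N n, ∃ y ∈ derived S N n, z = S.bracket x y}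

/-- A Lie superalgebra is semisimple if its only solvable ideal is zero. -/
def IsSemisimple (S : LieSuperalgebra k L) : Prop :=
  ∀ N : Submodule k L, S.IsIdeal N → (∃ n : ℕ, S.derived N n = ⊥) → N = ⊥

end Semisimple

section Tensor

variable (S : LieSuperalgebra k L) (A : Type*) [CommRing A] [Algebra k A]

/-- The subspace `Lᵢ ⊗ A` of `L ⊗ A`. -/
noncomputable def tensorPart (i : ZMod 2) : Submodule k (L ⊗[k] A) :=
  Submodule.span k {z : L ⊗[k] A | ∃ x ∈ S.part i, ∃ a : A, z = x ⊗ₜ[k] a}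

/-- The bilinear bracket on `L ⊗ A` with `[x ⊗ a, y ⊗ b] = [x, y] ⊗ ab`. -/
noncomputable def tensorBracket : L ⊗[k] A →ₗ[k] L ⊗[k] A →ₗ[k] L ⊗[k] A :=
  TensorProduct.map₂ S.bracket (LinearMap.mul k A)

@[simp]
theorem tensorBracket_tmul (x y : L) (a b : A) :
    S.tensorBracket A (x ⊗ₜ[k] a) (y ⊗ₜ[k] b) = S.bracket x y ⊗ₜ[k] (a * b) := by
  simp [tensorBracket]

theorem tensorPart_induction {i : ZMod 2} {P : L ⊗[k] A → Prop}
    (tmul : ∀ x ∈ S.part i, ∀ a : A, P (x ⊗ₜ[k] a)) (zero : P 0)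
    (add : ∀ x y, x ∈ S.tensorPart A i → y ∈ S.tensorPart A i → P x → P y → P (x + y))
    (z : L ⊗[k] A) (hz : z ∈ S.tensorPart A i) : P z := by
  refine Submodule.closure_induction (p := fun x _ => P x) zero
    (fun x y hx hy => add x y hx hy) ?_ hz
  rintro r _ ⟨x, hx, a, rfl⟩
  rw [TensorProduct.smul_tmul']
  exact tmul _ (Submodule.smul_mem _ r hx) a

theorem tensor_isCompl : IsCompl (S.tensorPart A 0) (S.tensorPart A 1) := by
  have key : ∀ i j : ZMod 2, IsCompl (S.part i) (S.part j) →
      ∃ P : L ⊗[k] A →ₗ[k] L ⊗[k] A, (∀ z ∈ S.tensorPart A i, P z = z) ∧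
        ∀ z ∈ S.tensorPart A j, P z = 0 := by
    intro i j h
    refine ⟨TensorProduct.map ((S.part i).subtype ∘ₗ Submodule.projectionOnto _ _ h)
      LinearMap.id, ?_, ?_⟩
    · refine S.tensorPart_induction A ?_ (by simp) ?_
      · intro x hx a
        have := Submodule.projectionOnto_apply_left h ⟨x, hx⟩
        simp only [TensorProduct.map_tmul, LinearMap.comp_apply, LinearMap.id_apply] at *
        rw [this]; rfl
      · intro x y _ _ hx hy
        rw [map_add, hx, hy]
    · refine S.tensorPart_induction A ?_ (by simp) ?_
      · intro x hx a
        have := Submodule.projectionOnto_apply_right h ⟨x, hx⟩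
        simp only [TensorProduct.map_tmul, LinearMap.comp_apply] at *
        rw [this]; simp
      · intro x y _ _ hx hy
        rw [map_add, hx, hy, add_zero]
  constructor
  · rw [Submodule.disjoint_def]
    intro z h0 h1
    obtain ⟨P, hP, hP'⟩ := key 0 1 S.isCompl
    rw [← hP z h0, hP' z h1]
  · rw [codisjoint_iff, eq_top_iff]
    rintro z -
    induction z using TensorProduct.induction_on with
    | zero => exact Submodule.zero_mem _
    | add x y hx hy => exact Submodule.add_mem _ hx hy
    | tmul x a =>
      have hx : x ∈ S.part 0 ⊔ S.part 1 := by rw [S.isCompl.sup_eq_top]; trivial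
      obtain ⟨y, hy, w, hw, rfl⟩ := Submodule.mem_sup.mp hx
      rw [TensorProduct.add_tmul]
      exact Submodule.add_mem_sup (Submodule.subset_span ⟨y, hy, a, rfl⟩)
        (Submodule.subset_span ⟨w, hw, a, rfl⟩)

theorem tensor_bracket_mem (i j : ZMod 2) (x y : L ⊗[k] A) (hx : x ∈ S.tensorPart A i)
    (hy : y ∈ S.tensorPart A j) : S.tensorBracket A x y ∈ S.tensorPart A (i + j) := by
  refine S.tensorPart_induction A
    (P := fun x => S.tensorBracket A x y ∈ S.tensorPart A (i + j))
    ?_ ?_ ?_ x hx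
  · intro u hu a
    refine S.tensorPart_induction A
      (P := fun y => S.tensorBracket A (u ⊗ₜ[k] a) y ∈ S.tensorPart A (i + j))
      ?_ (by simp) ?_ y hy
    · intro v hv b
      rw [tensorBracket_tmul]
      exact Submodule.subset_span ⟨_, S.bracket_mem i j u v hu hv, _, rfl⟩
    · intro v w _ _ hv hw
      rw [map_add]; exact Submodule.add_mem _ hv hw
  · simp
  · intro v w _ _ hv hw
    rw [map_add, LinearMap.add_apply]; exact Submodule.add_mem _ hv hw

theorem tensor_skew (i j : ZMod 2) (x y : L ⊗[k] A) (hx : x ∈ S.tensorPart A i)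
    (hy : y ∈ S.tensorPart A j) :
    S.tensorBracket A x y = -((-1 : k) ^ (i.val * j.val) • S.tensorBracket A y x) := by
  refine S.tensorPart_induction A
    (P := fun x => S.tensorBracket A x y = -((-1 : k) ^ (i.val * j.val) • S.tensorBracket A y x))
    ?_ ?_ ?_ x hx
  · intro u hu a
    refine S.tensorPart_induction A
      (P := fun y => S.tensorBracket A (u ⊗ₜ[k] a) y =
        -((-1 : k) ^ (i.val * j.val) • S.tensorBracket A y (u ⊗ₜ[k] a)))
      ?_ (by simp) ?_ y hy
    · intro v hv b
      rw [tensorBracket_tmul, tensorBracket_tmul, S.skew i j u v hu hv, mul_comm a b,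
        TensorProduct.neg_tmul, TensorProduct.smul_tmul']
    · intro v w _ _ hv hw
      rw [map_add, map_add, LinearMap.add_apply, hv, hw, smul_add, neg_add]
  · simp
  · intro v w _ _ hv hw
    rw [map_add, map_add, LinearMap.add_apply, hv, hw, smul_add, neg_add]

theorem tensor_jacobi (i j : ZMod 2) (x y z : L ⊗[k] A) (hx : x ∈ S.tensorPart A i)
    (hy : y ∈ S.tensorPart A j) :
    S.tensorBracket A x (S.tensorBracket A y z) =
      S.tensorBracket A (S.tensorBracket A x y) z +
        (-1 : k) ^ (i.val * j.val) • S.tensorBracket A y (S.tensorBracket A x z) := by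
  refine S.tensorPart_induction A
    (P := fun x => S.tensorBracket A x (S.tensorBracket A y z) =
      S.tensorBracket A (S.tensorBracket A x y) z +
        (-1 : k) ^ (i.val * j.val) • S.tensorBracket A y (S.tensorBracket A x z))
    ?_ ?_ ?_ x hx
  · intro u hu a
    refine S.tensorPart_induction A
      (P := fun y => S.tensorBracket A (u ⊗ₜ[k] a) (S.tensorBracket A y z) =
        S.tensorBracket A (S.tensorBracket A (u ⊗ₜ[k] a) y) z +
          (-1 : k) ^ (i.val * j.val) • S.tensorBracket A y (S.tensorBracket A (u ⊗ₜ[k] a) z))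
      ?_ (by simp) ?_ y hy
    · intro v hv b
      induction z using TensorProduct.induction_on with
      | zero => simp
      | add s t hs ht =>
        simp only [map_add, smul_add, hs, ht]
        abel
      | tmul w c =>
        simp only [tensorBracket_tmul]
        rw [S.jacobi i j u v w hu hv, TensorProduct.add_tmul, TensorProduct.smul_tmul',
          mul_assoc, mul_left_comm b a c]
    · intro v w _ _ hv hw
      simp only [map_add, LinearMap.add_apply, hv, hw, smul_add]
      abel
  · simp
  · intro v w _ _ hv hw
    simp only [map_add, LinearMap.add_apply, hv, hw, smul_add]
    abel

theorem tensor_odd_cube (x : L ⊗[k] A) (hx : x ∈ S.tensorPart A 1) :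
    S.tensorBracket A x (S.tensorBracket A x x) = 0 := by
  have cross : ∀ u v : L ⊗[k] A, u ∈ S.tensorPart A 1 → v ∈ S.tensorPart A 1 →
      S.tensorBracket A u (S.tensorBracket A u v) + S.tensorBracket A u (S.tensorBracket A v u)
        + S.tensorBracket A v (S.tensorBracket A u u) = 0 := by
    intro u v hu hv
    have h1 := S.tensor_jacobi A 1 1 u v u hu hv
    have h2 := S.tensor_skew A 1 1 u v hu hv
    have h3 := S.tensor_skew A (1 + 1) 1 _ u (S.tensor_bracket_mem A 1 1 u v hu hv) hu
    have e1 : (1 : ZMod 2).val = 1 := rfl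
    have e2 : (1 + 1 : ZMod 2).val = 0 := rfl
    simp only [e1, e2, mul_one, pow_one, pow_zero, one_smul, neg_smul, neg_neg] at *
    rw [h3] at h1
    rw [h1]
    abel
  refine S.tensorPart_induction A
    (P := fun x => S.tensorBracket A x (S.tensorBracket A x x) = 0)
    ?_ ?_ ?_ x hx
  · intro u hu a
    simp [S.odd_cube u hu]
  · simp
  · intro u v hu hv h1 h2
    have c1 := cross u v hu hv
    have c2 := cross v u hv hu
    simp only [map_add, LinearMap.add_apply, h1, h2]
    calc _ = (S.tensorBracket A u (S.tensorBracket A u v)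
          + S.tensorBracket A u (S.tensorBracket A v u)
          + S.tensorBracket A v (S.tensorBracket A u u))
          + (S.tensorBracket A v (S.tensorBracket A v u)
          + S.tensorBracket A v (S.tensorBracket A u v)
          + S.tensorBracket A u (S.tensorBracket A v v)) := by abel
      _ = 0 := by rw [c1, c2, add_zero]

/-- The Lie superalgebra `L ⊗ A`, for a commutative algebra `A` placed in even degree. -/
noncomputable def tensor : LieSuperalgebra k (L ⊗[k] A) where
  part := S.tensorPart A
  isCompl := S.tensor_isCompl A
  bracket := S.tensorBracket A
  bracket_mem := S.tensor_bracket_mem A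
  skew := S.tensor_skew A
  jacobi := S.tensor_jacobi A
  odd_cube := S.tensor_odd_cube A

/-- The current superalgebra `L[x] = L ⊗ k[x]`. -/
noncomputable def current : LieSuperalgebra k (L ⊗[k] k[X]) := S.tensor k[X]

/-- The loop superalgebra `L(x) = L ⊗ k[x, x⁻¹]`. -/
noncomputable def loop : LieSuperalgebra k (L ⊗[k] k[T;T⁻¹]) := S.tensor k[T;T⁻¹]

end Tensor

section Restricted

/-- A restricted structure on a Lie superalgebra (in characteristic `p`): a `p`-th power map
`x ↦ x^[p]` on the even part making `L₀` a restricted Lie algebra and `L₁` a restricted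
`L₀`-module. -/
structure Restriction (S : LieSuperalgebra k L) (p : ℕ) where
  pmap : S.part 0 → S.part 0
  pmap_smul : ∀ (a : k) (x : S.part 0), pmap (a • x) = a ^ p • pmap x
  /-- `ad (x^[p]) = (ad x)^p` on all of `L`. -/
  ad_pmap : ∀ x : S.part 0,
    (S.bracket (pmap x : L) : Module.End k L) = (S.bracket (x : L) : Module.End k L) ^ p
  /-- Jacobson's formula: `(x + y)^[p] = x^[p] + y^[p] + s₁ + ⋯ + sₚ₋₁`, where `i sᵢ` is the
  coefficient of `tⁱ⁻¹` in `(ad (t x + y))^(p-1) (x)`, computed in `L ⊗ k[t]`. -/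
  pmap_add : ∀ x y : S.part 0, ∃ s : ℕ → L,
    ((S.tensorBracket k[X] ((x : L) ⊗ₜ[k] Polynomial.X + (y : L) ⊗ₜ[k] 1) :
        Module.End k (L ⊗[k] k[X])) ^ (p - 1)) ((x : L) ⊗ₜ[k] 1) =
      ∑ i ∈ Finset.Icc 1 (p - 1), ((i : k) • s i) ⊗ₜ[k] (Polynomial.X ^ (i - 1) : k[X]) ∧
    (pmap (x + y) : L) = pmap x + pmap y + ∑ i ∈ Finset.Icc 1 (p - 1), s i

end Restricted

section Enveloping

variable (S : LieSuperalgebra k L)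

/-- The defining relations `xy = (-1)^{|x||y|} yx + [x, y]` (`x`, `y` homogeneous) of the
universal enveloping algebra. -/
inductive EnvRel : TensorAlgebra k L → TensorAlgebra k L → Prop
  | comm (i j : ZMod 2) (x y : L) (hx : x ∈ S.part i) (hy : y ∈ S.part j) :
      EnvRel (TensorAlgebra.ι k x * TensorAlgebra.ι k y)
        ((-1 : k) ^ (i.val * j.val) • (TensorAlgebra.ι k y * TensorAlgebra.ι k x)
          + TensorAlgebra.ι k (S.bracket x y))

/-- The universal enveloping algebra of a Lie superalgebra. -/
abbrev Env : Type _ := RingQuot S.EnvRel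

/-- The canonical map from a Lie superalgebra to its universal enveloping algebra. -/
noncomputable def envι : L →ₗ[k] S.Env :=
  (RingQuot.mkAlgHom k S.EnvRel).toLinearMap ∘ₗ TensorAlgebra.ι k

/-- The `ℤ/2`-grading of the universal enveloping algebra: the part of degree `i` is spanned by
the products of homogeneous elements of `L` whose degrees add up to `i`. -/
noncomputable def envPart (i : ZMod 2) : Submodule k S.Env :=
  Submodule.span k {u : S.Env | ∃ l : List (Σ j : ZMod 2, S.part j),
    (l.map Sigma.fst).sum = i ∧ u = (l.map fun x => S.envι (x.2 : L)).prod}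

/-- The homogeneous elements `z` of degree `i` of the enveloping algebra such that
`zu - (-1)^{|z||u|} uz = 0` for all homogeneous `u`. -/
noncomputable def centerPart (i : ZMod 2) : Submodule k S.Env where
  carrier := {z | z ∈ S.envPart i ∧ ∀ (j : ZMod 2), ∀ u ∈ S.envPart j,
    z * u - (-1 : k) ^ (i.val * j.val) • (u * z) = 0}
  zero_mem' := ⟨Submodule.zero_mem _, by simp⟩
  add_mem' := by
    rintro a b ⟨ha, ha'⟩ ⟨hb, hb'⟩
    refine ⟨Submodule.add_mem _ ha hb, fun j u hu => ?_⟩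
    have h1 := ha' j u hu
    have h2 := hb' j u hu
    rw [add_mul, mul_add, smul_add, add_sub_add_comm, h1, h2, add_zero]
  smul_mem' := by
    rintro c a ⟨ha, ha'⟩
    refine ⟨Submodule.smul_mem _ c ha, fun j u hu => ?_⟩
    have h1 := ha' j u hu
    rw [smul_mul_assoc, mul_smul_comm, smul_comm, ← smul_sub, h1, smul_zero]

/-- The center of the universal enveloping algebra: all `z` whose supercommutator
`[z, u] = zu - (-1)^{|z||u|} uz`, extended bilinearly from homogeneous elements, vanishes for
every `u`. For homogeneous `u` the brackets of `u` with the even and with the odd component of `z`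
have different degrees, so this means that both components supercommute with everything. -/
noncomputable def envCenter : Submodule k S.Env := S.centerPart 0 ⊔ S.centerPart 1

end Enveloping

end LieSuperalgebra

/-- A subspace `Z` of an associative algebra `U` is freely generated, as a commutative algebra, by
the family `v`: there is an algebra homomorphism from the polynomial algebra in indeterminates
`Xᵢ` to `U` that sends `Xᵢ` to `vᵢ`, is injective and has image `Z`. -/
def FreelyGeneratedBy {k U ι : Type*} [Field k] [Ring U] [Algebra k U] (Z : Submodule k U)
    (v : ι → U) : Prop :=
  ∃ φ : MvPolynomial ι k →ₐ[k] U, (∀ i, φ (MvPolynomial.X i) = v i) ∧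
    Function.Injective φ ∧ Set.range φ = (Z : Set U)

/-! Choose a totally ordered homogeneous basis of `L ⊗ A`. By the Poincaré–Birkhoff–Witt theorem the
sorted words without repeated odd letters form a basis of the enveloping algebra. The theorem is
obtained by rewriting: a descent `ij` becomes `±ji + [i, j]`, and an odd square `ii` becomes `½[i,
i]`. Each resulting word is shorter or has fewer inversions, and overlapping reductions agree by the
super Jacobi identity and `[x, [x, x]] = 0` (`overlap`, `reductionsAgree`). So the normal form kills
the defining relations (`normalTensor_relator`), and `envPBW` records the result.

The elements `x ^ p - x^[p]` are central because `(ad x) ^ p = ad (x ^ p)` in characteristic `p`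
(`pow_sub_mem_center`). Distinct monomials in them have distinct leading words, which gives
algebraic independence (`centralHom_injective`).

The main point is that nothing else is central. Let `z` be homogeneous and supercentral, with words
of length at most `n`. Bracket it with `y ⊗ a m`, where `m` is so large that all new exponents
exceed those in `z`. Modulo shorter words, the bracket deletes one letter from a word and appends a
combination of larger letters, so the outcome is already sorted and coefficients can be read off.
For a word `v` of length `n - 1`, take the signed sum of all letters whose deletion from a word of
`z` leaves `v`, weighted by the coefficients of `z`. All `y ⊗ a m` kill this vector, and a
semisimple `L` has trivial center, so it vanishes (`sum_deletions_eq_zero`). Since `v` and the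
deleted letter determine a sorted word, the coefficient of each leading word times the signed
multiplicity of each of its letters is zero. Hence leading words have only even letters, with
multiplicities divisible by `p` (`par_eq_zero_and_count_eq_zero`). They are leading words of
monomials in the `x ^ p - x^[p]`; subtracting those and inducting on length finishes the proof
(`superCentral_le_range_centralHom`). -/

/-! ### Inversions, Koszul signs, homogeneous bases and the rewriting of words. -/

/-- The number of inversions of a word in a linearly ordered alphabet. -/
def List.inversionCount {ι : Type*} [LinearOrder ι] : List ι → ℕ
  | [] => 0
  | x :: l => l.countP (· < x) + inversionCount l

theorem List.inversionCount_swap_lt {ι : Type*} [LinearOrder ι] (u v : List ι) {i j : ι}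
    (h : j < i) : (u ++ j :: i :: v).inversionCount < (u ++ i :: j :: v).inversionCount := by
  induction u with
  | nil => simp [List.inversionCount, h, h.not_gt]; omega
  | cons x u ih =>
    have hp : (u ++ j :: i :: v).countP (· < x) = (u ++ i :: j :: v).countP (· < x) :=
      ((List.Perm.swap i j v).append_left u).countP_eq _
    simp only [List.cons_append, List.inversionCount, hp]
    omega

namespace LieSuperalgebra

open Module

/-- The sign `(-1)^{ij}` of the Koszul rule. -/
def koszulSign (k : Type*) [Field k] (i j : ZMod 2) : k := (-1) ^ (i.val * j.val)

section KoszulSign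

variable {k : Type*} [Field k]

theorem zmod_two_cases (i : ZMod 2) : i = 0 ∨ i = 1 := by
  revert i; decide

@[simp] theorem koszulSign_zero_left (i : ZMod 2) : koszulSign k 0 i = 1 := by
  simp [koszulSign]

@[simp] theorem koszulSign_zero_right (i : ZMod 2) : koszulSign k i 0 = 1 := by
  simp [koszulSign]

@[simp] theorem koszulSign_one_one : koszulSign k 1 1 = -1 := by
  simp [koszulSign, ZMod.val_one]

theorem zmod_two_one_add_one : (1 + 1 : ZMod 2) = 0 := rfl

theorem koszulSign_comm (i j : ZMod 2) : koszulSign k i j = koszulSign k j i := by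
  simp [koszulSign, mul_comm]

theorem koszulSign_add_left (i j l : ZMod 2) :
    koszulSign k (i + j) l = koszulSign k i l * koszulSign k j l := by
  rcases zmod_two_cases i with rfl | rfl <;> rcases zmod_two_cases j with rfl | rfl <;>
    rcases zmod_two_cases l with rfl | rfl <;> simp [zmod_two_one_add_one]

theorem koszulSign_add_right (i j l : ZMod 2) :
    koszulSign k i (j + l) = koszulSign k i j * koszulSign k i l := by
  rw [koszulSign_comm, koszulSign_add_left, koszulSign_comm j, koszulSign_comm l]

theorem koszulSign_mul_self (i j : ZMod 2) : koszulSign k i j * koszulSign k i j = 1 := by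
  rcases zmod_two_cases i with rfl | rfl <;> rcases zmod_two_cases j with rfl | rfl <;> simp

theorem koszulSign_ne_zero (i j : ZMod 2) : koszulSign k i j ≠ 0 :=
  left_ne_zero_of_mul_eq_one (koszulSign_mul_self i j)

end KoszulSign

variable {k : Type*} {V : Type*} [Field k] [AddCommGroup V] [Module k V]

/-- A basis of a Lie superalgebra that consists of homogeneous elements. -/
structure HomogeneousBasis (S : LieSuperalgebra k V) (ι : Type*) where
  basis : Basis ι k V
  par : ι → ZMod 2
  mem : ∀ i, basis i ∈ S.part (par i)

namespace HomogeneousBasis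

variable {S : LieSuperalgebra k V} {ι : Type*} (B : S.HomogeneousBasis ι)

theorem eq_zero_of_mem_of_ne {i j : ZMod 2} (hij : i ≠ j) {x : V} (hi : x ∈ S.part i)
    (hj : x ∈ S.part j) : x = 0 := by
  have := Submodule.disjoint_def.mp S.isCompl.disjoint
  rcases zmod_two_cases i with rfl | rfl <;> rcases zmod_two_cases j with rfl | rfl
  · exact absurd rfl hij
  · exact this x hi hj
  · exact this x hj hi
  · exact absurd rfl hij

/-- Cut the expansion of `x` by the parity of the basis vectors. The sub-sum of the wrong parity is
`x` minus an element of the right part, so it lies in both parts and is zero. -/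
theorem part_eq_span (i : ZMod 2) : S.part i = Submodule.span k (B.basis '' {l | B.par l = i}) := by
  apply le_antisymm
  · intro x hx
    classical
    have key : ∀ j, (∑ l ∈ (B.basis.repr x).support with B.par l = j,
        B.basis.repr x l • B.basis l) ∈ Submodule.span k (B.basis '' {l | B.par l = j}) :=
      fun j => Submodule.sum_mem _ fun l hl => Submodule.smul_mem _ _
        (Submodule.subset_span ⟨l, (Finset.mem_filter.mp hl).2, rfl⟩)
    have hle : ∀ j, Submodule.span k (B.basis '' {l | B.par l = j}) ≤ S.part j := by
      intro j
      rw [Submodule.span_le]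
      rintro _ ⟨l, rfl, rfl⟩
      exact B.mem l
    have hsum : (∑ l ∈ (B.basis.repr x).support with B.par l = i,
        B.basis.repr x l • B.basis l) + (∑ l ∈ (B.basis.repr x).support with ¬ B.par l = i,
        B.basis.repr x l • B.basis l) = x := by
      rw [Finset.sum_filter_add_sum_filter_not]
      exact B.basis.linearCombination_repr x
    have hne : ∀ l, (¬ B.par l = i) ↔ B.par l = i + 1 := by
      intro l
      rcases zmod_two_cases i with rfl | rfl <;> rcases zmod_two_cases (B.par l) with h | h <;>
        simp [h, zmod_two_one_add_one]
    simp only [hne] at hsum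
    have h1 := hle _ (key i)
    have h2 := hle _ (key (i + 1))
    have h3 : (∑ l ∈ (B.basis.repr x).support with B.par l = i + 1,
        B.basis.repr x l • B.basis l) = 0 := by
      refine eq_zero_of_mem_of_ne (i := i) (j := i + 1) (by simp) ?_ h2
      rw [← eq_sub_iff_add_eq'] at hsum
      rw [hsum]
      exact Submodule.sub_mem _ hx h1
    rw [h3, add_zero] at hsum
    rw [← hsum]
    exact key i
  · rw [Submodule.span_le]
    rintro _ ⟨l, rfl, rfl⟩
    exact B.mem l

theorem par_eq_of_repr_ne_zero {i : ZMod 2} {x : V} (hx : x ∈ S.part i) {l : ι}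
    (hl : B.basis.repr x l ≠ 0) : B.par l = i := by
  rw [B.part_eq_span, Basis.mem_span_image] at hx
  exact hx (Finsupp.mem_support_iff.mpr hl)

/-- The word `w` in the basis, as an element of the tensor algebra. -/
noncomputable def tensorWord (w : List ι) : TensorAlgebra k V :=
  (w.map fun i => TensorAlgebra.ι k (B.basis i)).prod

@[simp] theorem tensorWord_nil : B.tensorWord [] = 1 := rfl

@[simp] theorem tensorWord_cons (i : ι) (w : List ι) :
    B.tensorWord (i :: w) = TensorAlgebra.ι k (B.basis i) * B.tensorWord w := by
  simp [tensorWord]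

@[simp] theorem tensorWord_append (u w : List ι) :
    B.tensorWord (u ++ w) = B.tensorWord u * B.tensorWord w := by
  simp [tensorWord]

theorem tensorAlgebra_basis_apply (w : List ι) :
    B.basis.tensorAlgebra (FreeMonoid.ofList w) = B.tensorWord w := by
  have h : FreeAlgebra.basisFreeMonoid k ι (FreeMonoid.ofList w)
      = (w.map (FreeAlgebra.ι k)).prod := by
    simp only [FreeAlgebra.basisFreeMonoid, Basis.map_apply, Finsupp.coe_basisSingleOne]
    change FreeAlgebra.equivMonoidAlgebraFreeMonoid.symm (MonoidAlgebra.single (FreeMonoid.ofList w) 1) = _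
    change MonoidAlgebra.lift k (FreeAlgebra k ι) (FreeMonoid ι) (FreeMonoid.lift (FreeAlgebra.ι k)) _ = _
    simp [FreeMonoid.lift_ofList]
  rw [Basis.tensorAlgebra, Basis.map_apply, h, AlgEquiv.toLinearEquiv_apply, map_list_prod, tensorWord,
    List.map_map]
  congr 2
  ext i
  simp

theorem tensorAlgebra_ext {M : Type*} [AddCommGroup M] [Module k M]
    {f g : TensorAlgebra k V →ₗ[k] M} (h : ∀ w, f (B.tensorWord w) = g (B.tensorWord w)) :
    f = g :=
  B.basis.tensorAlgebra.ext fun w => by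
    have := h (FreeMonoid.toList w)
    rwa [← tensorAlgebra_basis_apply, FreeMonoid.ofList_toList] at this

variable [LinearOrder ι]

/-- The two-letter words `i j` that are to be rewritten: descents and squares of odd letters. -/
def Reducible (i j : ι) : Prop := j < i ∨ i = j ∧ B.par i = 1

/-- The coefficient of the transposed word in the rewriting rule for `i j`. -/
def swapCoeff (i j : ι) : k := if i = j then 0 else koszulSign k (B.par i) (B.par j)

/-- The linear term in the rewriting rule for `i j`. -/
noncomputable def remainder (i j : ι) : V :=
  -- For an odd letter the defining relation says `2x² = [x, x]`.
  if i = j then (2 : k)⁻¹ • S.bracket (B.basis i) (B.basis j)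
    else S.bracket (B.basis i) (B.basis j)

open Classical in
/-- The normal form of a word, a linear combination of irreducible words. -/
noncomputable def normalWord (w : List ι) : List ι →₀ k :=
  if h : ∃ d : List ι × ι × ι × List ι,
      w = d.1 ++ d.2.1 :: d.2.2.1 :: d.2.2.2 ∧ B.Reducible d.2.1 d.2.2.1 then
    -- For a square the swap coefficient is zero anyway. The test keeps the recursive call to strict
    -- descents, where the transposed word has fewer inversions.
    (if h.choose.2.1 = h.choose.2.2.1 then 0 else
      B.swapCoeff h.choose.2.1 h.choose.2.2.1 •
        normalWord (h.choose.1 ++ h.choose.2.2.1 :: h.choose.2.1 :: h.choose.2.2.2)) +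
    (B.basis.repr (B.remainder h.choose.2.1 h.choose.2.2.1)).sum
      fun l a => a • normalWord (h.choose.1 ++ l :: h.choose.2.2.2)
  else Finsupp.single w 1
termination_by (w.length, w.inversionCount)
decreasing_by
  · rename_i hne
    obtain ⟨h1, h2⟩ := h.choose_spec
    have h3 := h2.resolve_right fun h4 => hne h4.1
    have hl : (h.choose.1 ++ h.choose.2.2.1 :: h.choose.2.1 :: h.choose.2.2.2).length
        = w.length := by conv_rhs => rw [h1]
                         simp
    rw [hl]
    apply Prod.Lex.right
    conv_rhs => rw [h1]
    exact List.inversionCount_swap_lt _ _ h3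
  · apply Prod.Lex.left
    conv_rhs => rw [h.choose_spec.1]
    simp

end HomogeneousBasis
end LieSuperalgebra

/-! ### Normal forms in context and the defining relations. -/

namespace LieSuperalgebra

open Module

variable {k : Type*} {V : Type*} [Field k] [AddCommGroup V] [Module k V]

/-- The defining relation of the enveloping algebra, in the tensor algebra, for `x` and `y` of
parities `s` and `t`. -/
noncomputable def relator (S : LieSuperalgebra k V) (s t : ZMod 2) (x y : V) : TensorAlgebra k V :=
  TensorAlgebra.ι k x * TensorAlgebra.ι k y
    - (koszulSign k s t • (TensorAlgebra.ι k y * TensorAlgebra.ι k x)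
      + TensorAlgebra.ι k (S.bracket x y))

namespace HomogeneousBasis

variable {S : LieSuperalgebra k V} {ι : Type*} (B : S.HomogeneousBasis ι) [LinearOrder ι]

local notation "τ" => TensorAlgebra.ι k

/-- The normal form, as a linear map on the tensor algebra. -/
noncomputable def normalTensor : TensorAlgebra k V →ₗ[k] (List ι →₀ k) :=
  B.basis.tensorAlgebra.constr k fun w => B.normalWord (FreeMonoid.toList w)

theorem normalTensor_tensorWord (w : List ι) :
    B.normalTensor (B.tensorWord w) = B.normalWord w := by
  rw [← tensorAlgebra_basis_apply, normalTensor, Basis.constr_basis, FreeMonoid.toList_ofList]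

/-- The right-hand side of the rewriting rule for `i j`. -/
noncomputable def rewriteTerm (i j : ι) : TensorAlgebra k V :=
  B.swapCoeff i j • (τ (B.basis j) * τ (B.basis i)) + τ (B.remainder i j)

/-- The normal form map in the context of a prefix `u` and a suffix `v`. -/
noncomputable def normalContext (u v : List ι) : TensorAlgebra k V →ₗ[k] (List ι →₀ k) :=
  B.normalTensor ∘ₗ LinearMap.mulLeft k (B.tensorWord u) ∘ₗ LinearMap.mulRight k (B.tensorWord v)

theorem normalContext_apply (u v : List ι) (t : TensorAlgebra k V) :
    B.normalContext u v t = B.normalTensor (B.tensorWord u * (t * B.tensorWord v)) := rfl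

theorem normalContext_concat (u v : List ι) (i : ι) (t : TensorAlgebra k V) :
    B.normalContext (u ++ [i]) v t = B.normalContext u v (τ (B.basis i) * t) := by
  simp [normalContext_apply, mul_assoc]

theorem normalContext_cons (u v : List ι) (i : ι) (t : TensorAlgebra k V) :
    B.normalContext u (i :: v) t = B.normalContext u v (t * τ (B.basis i)) := by
  simp [normalContext_apply, mul_assoc]

theorem normalContext_tensorWord (u v w : List ι) :
    B.normalContext u v (B.tensorWord w) = B.normalWord (u ++ w ++ v) := by
  rw [normalContext_apply, ← normalTensor_tensorWord]
  simp

theorem normalContext_pair (u v : List ι) (i j : ι) :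
    B.normalContext u v (τ (B.basis i) * τ (B.basis j)) = B.normalWord (u ++ i :: j :: v) := by
  rw [← normalTensor_tensorWord]
  simp [normalContext_apply, mul_assoc]

theorem normalContext_ι (u v : List ι) (x : V) :
    B.normalContext u v (τ x) =
      (B.basis.repr x).sum fun l a => a • B.normalWord (u ++ l :: v) := by
  conv_lhs => rw [← B.basis.linearCombination_repr x]
  rw [Finsupp.linearCombination_apply, Finsupp.sum, map_sum, map_sum, Finsupp.sum]
  refine Finset.sum_congr rfl fun l _ => ?_
  rw [map_smul, map_smul, ← normalTensor_tensorWord]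
  simp [normalContext_apply]

theorem normalWord_cases (w : List ι) :
    (∃ u i j v, w = u ++ i :: j :: v ∧ B.Reducible i j ∧
      B.normalWord w = B.normalContext u v (B.rewriteTerm i j)) ∨
    (∀ u i j v, w = u ++ i :: j :: v → ¬ B.Reducible i j) ∧
      B.normalWord w = Finsupp.single w 1 := by
  by_cases h : ∃ d : List ι × ι × ι × List ι,
      w = d.1 ++ d.2.1 :: d.2.2.1 :: d.2.2.2 ∧ B.Reducible d.2.1 d.2.2.1
  · refine Or.inl ⟨_, _, _, _, h.choose_spec.1, h.choose_spec.2, ?_⟩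
    rw [normalWord, dif_pos h, rewriteTerm, map_add, map_smul, normalContext_ι, normalContext_pair]
    congr 1
    split_ifs with h'
    · rw [swapCoeff, if_pos h', zero_smul]
    · rfl
  · refine Or.inr ⟨fun u i j v hw hr => h ⟨(u, i, j, v), hw, hr⟩, ?_⟩
    rw [normalWord, dif_neg h]

/-- All reductions of words that satisfy `P` compute the normal form. -/
def ReductionsAgree (P : List ι → Prop) : Prop :=
  ∀ u i j v, P (u ++ i :: j :: v) → B.Reducible i j →
    B.normalWord (u ++ i :: j :: v) = B.normalContext u v (B.rewriteTerm i j)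

variable {B}

/-- For a descent this is the rewriting rule, and for an ascent the rule for the transposed pair, by
skew symmetry. An even letter has `[x, x] = 0` as `2 ≠ 0`; for an odd one the two halves `½[x, x]`
add up. -/
theorem normalContext_relator_basis (h2 : (2 : k) ≠ 0) {n : ℕ}
    (H : B.ReductionsAgree fun w => w.length < n) {u v : List ι} (i j : ι)
    (hn : u.length + v.length + 2 < n) :
    B.normalContext u v (S.relator (B.par i) (B.par j) (B.basis i) (B.basis j)) = 0 := by
  have hH : ∀ i j, B.Reducible i j →
      B.normalContext u v (τ (B.basis i) * τ (B.basis j)) =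
        B.normalContext u v (B.rewriteTerm i j) := by
    intro i j hr
    rw [normalContext_pair]
    refine H u i j v ?_ hr
    simp only [List.length_append, List.length_cons]
    omega
  have hsk := S.skew (B.par i) (B.par j) _ _ (B.mem i) (B.mem j)
  change _ = -(koszulSign k _ _ • _) at hsk
  have hs := koszulSign_mul_self (k := k) (B.par i) (B.par j)
  simp only [relator, map_sub, map_add, map_smul]
  rcases lt_trichotomy j i with h | h | h
  · rw [hH i j (Or.inl h), rewriteTerm, swapCoeff, remainder, if_neg h.ne', if_neg h.ne']
    simp
  · subst h
    rcases zmod_two_cases (B.par j) with hp | hp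
    · rw [hp] at hsk ⊢
      have h0 : S.bracket (B.basis j) (B.basis j) = 0 := by
        simp only [koszulSign_zero_left, one_smul] at hsk
        have : (2 : k) • S.bracket (B.basis j) (B.basis j) = 0 := by
          rw [two_smul, ← sub_neg_eq_add, ← hsk, sub_self]
        exact (smul_eq_zero.mp this).resolve_left h2
      simp [h0]
    · have := hH j j (Or.inr ⟨rfl, hp⟩)
      rw [rewriteTerm, swapCoeff, remainder, if_pos rfl, if_pos rfl] at this
      rw [this, hp]
      simp only [zero_smul, zero_add, map_smul, koszulSign_one_one, neg_smul, one_smul]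
      rw [sub_eq_zero, eq_neg_add_iff_add_eq, ← add_smul]
      have : (2 : k)⁻¹ + 2⁻¹ = 1 := by field_simp; norm_num
      rw [this, one_smul]
  · rw [hH j i (Or.inl h), rewriteTerm, swapCoeff, remainder, if_neg h.ne', if_neg h.ne', hsk,
      koszulSign_comm (B.par j)]
    simp [smul_smul, hs]

theorem normalContext_relator (h2 : (2 : k) ≠ 0) {n : ℕ}
    (H : B.ReductionsAgree fun w => w.length < n) {u v : List ι}
    (hn : u.length + v.length + 2 < n) (s t : ZMod 2) (x y : V) (hx : x ∈ S.part s)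
    (hy : y ∈ S.part t) :
    B.normalContext u v (S.relator s t x y) = 0 := by
  rw [B.part_eq_span] at hx hy
  induction hx using Submodule.span_induction with
  | zero => simp [relator]
  | add x x' _ _ h h' =>
    have : S.relator s t (x + x') y = S.relator s t x y + S.relator s t x' y := by
      simp only [relator, map_add, add_mul, mul_add, smul_add, LinearMap.add_apply]; abel
    rw [this, map_add, h, h', add_zero]
  | smul c x _ h =>
    have : S.relator s t (c • x) y = c • S.relator s t x y := by
      simp only [relator, map_smul, smul_mul_assoc, mul_smul_comm, LinearMap.smul_apply, smul_sub,
        smul_add, smul_comm c]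
    rw [this, map_smul, h, smul_zero]
  | mem x hx =>
    obtain ⟨i, rfl, rfl⟩ := hx
    induction hy using Submodule.span_induction with
    | zero => simp [relator]
    | add y y' _ _ h h' =>
      have : S.relator (B.par i) t (B.basis i) (y + y') =
          S.relator (B.par i) t (B.basis i) y + S.relator (B.par i) t (B.basis i) y' := by
        simp only [relator, map_add, add_mul, mul_add, smul_add]; abel
      rw [this, map_add, h, h', add_zero]
    | smul c y _ h =>
      have : S.relator (B.par i) t (B.basis i) (c • y) =
          c • S.relator (B.par i) t (B.basis i) y := by
        simp only [relator, map_smul, smul_mul_assoc, mul_smul_comm, smul_sub,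
          smul_add, smul_comm c]
      rw [this, map_smul, h, smul_zero]
    | mem y hy =>
      obtain ⟨j, rfl, rfl⟩ := hy
      exact normalContext_relator_basis h2 H i j hn

end HomogeneousBasis
end LieSuperalgebra

/-! ### Overlap ambiguities and the Jacobi identity. -/

namespace LieSuperalgebra

open Module

variable {k : Type*} {V : Type*} [Field k] [AddCommGroup V] [Module k V]

namespace HomogeneousBasis

variable {S : LieSuperalgebra k V} {ι : Type*} (B : S.HomogeneousBasis ι) [LinearOrder ι]

local notation "τ" => TensorAlgebra.ι k

theorem remainder_mem (i j : ι) : B.remainder i j ∈ S.part (B.par i + B.par j) := by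
  have := S.bracket_mem _ _ _ _ (B.mem i) (B.mem j)
  rw [remainder]
  split_ifs with h
  · exact Submodule.smul_mem _ _ this
  · exact this

variable {B}

/-- The word `xyz` can be reduced at `xy` or at `yz`. Continuing with the given further reductions,
both ways reach `zyx` if all three letters differ, and no word of length three otherwise. What is
left are words of length two and one, which are compared using `hlow` and the Jacobi identity. -/
theorem overlap (h2 : (2 : k) ≠ 0) {M : Type*} [AddCommGroup M] [Module k M]
    (f : TensorAlgebra k V →ₗ[k] M) {x y z : ι}
    (hlow : ∀ (s t : ZMod 2) (a b : V), a ∈ S.part s → b ∈ S.part t →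
      f (τ a * τ b) = koszulSign k s t • f (τ b * τ a) + f (τ (S.bracket a b)))
    (h₁ : B.Reducible x y) (h₂ : B.Reducible y z)
    (hyxz : y < x → f (τ (B.basis y) * τ (B.basis x) * τ (B.basis z)) =
      f (τ (B.basis y) * B.rewriteTerm x z))
    (hyzx : y < x → z < x → f (τ (B.basis y) * τ (B.basis z) * τ (B.basis x)) =
      f (B.rewriteTerm y z * τ (B.basis x)))
    (hxzy : z < y → f (τ (B.basis x) * τ (B.basis z) * τ (B.basis y)) =
      f (B.rewriteTerm x z * τ (B.basis y)))
    (hzxy : z < y → z < x → f (τ (B.basis z) * τ (B.basis x) * τ (B.basis y)) =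
      f (τ (B.basis z) * B.rewriteTerm x y)) :
    f (B.rewriteTerm x y * τ (B.basis z)) = f (τ (B.basis x) * B.rewriteTerm y z) := by
  have hjac := S.jacobi _ _ _ _ (B.basis z) (B.mem x) (B.mem y)
  change _ = _ + koszulSign k _ _ • _ at hjac
  have hjac' := congrArg (fun a => f (τ a)) hjac
  simp only [map_add, map_smul] at hjac'
  have l1 := hlow _ _ _ _ (S.bracket_mem _ _ _ _ (B.mem x) (B.mem y)) (B.mem z)
  have l2 := hlow _ _ _ _ (B.mem y) (S.bracket_mem _ _ _ _ (B.mem x) (B.mem z))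
  have l3 := hlow _ _ _ _ (B.mem x) (S.bracket_mem _ _ _ _ (B.mem y) (B.mem z))
  have hhalf : ∀ m : M, m = (2 : k)⁻¹ • m + (2 : k)⁻¹ • m := by
    intro m
    rw [← add_smul, ← two_mul, mul_inv_cancel₀ h2, one_smul]
  rcases h₁ with h₁ | ⟨rfl, h₁⟩ <;> rcases h₂ with h₂ | ⟨rfl, h₂⟩
  · have h₃ := h₂.trans h₁
    specialize hyxz h₁
    specialize hyzx h₁ h₃
    specialize hxzy h₂
    specialize hzxy h₂ h₃
    simp only [rewriteTerm, swapCoeff, remainder, if_neg h₁.ne', if_neg h₂.ne', if_neg h₃.ne',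
      add_mul, mul_add, smul_mul_assoc, mul_smul_comm, map_add, map_smul, ← mul_assoc] at *
    rw [hyxz, hyzx, hxzy, hzxy, l1, l2, l3, hjac']
    rcases zmod_two_cases (B.par x) with h | h <;> rcases zmod_two_cases (B.par y) with h' | h' <;>
    rcases zmod_two_cases (B.par z) with h'' | h'' <;>
    simp only [h, h', h'', zmod_two_one_add_one, zero_add, add_zero, koszulSign_zero_left,
      koszulSign_zero_right, koszulSign_one_one] <;> module
  -- Here `z = y` is odd. By Jacobi and skew symmetry `½[x, [y, y]]` is, up to sign, `[y, [x, y]]`;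
  -- `hC` splits that term into halves.
  · specialize hyxz h₁
    specialize hyzx h₁ h₁
    simp only [rewriteTerm, swapCoeff, remainder, if_neg h₁.ne', if_true,
      add_mul, mul_add, smul_mul_assoc, mul_smul_comm, map_add, map_smul, ← mul_assoc, zero_smul,
      zero_add] at *
    have hsk := S.skew _ _ _ _ (S.bracket_mem _ _ _ _ (B.mem x) (B.mem y)) (B.mem y)
    change _ = -(koszulSign k _ _ • _) at hsk
    have hsk' := congrArg (fun a => f (τ a)) hsk
    simp only [map_neg, map_smul] at hsk'
    rw [hyxz, hyzx, l2, l3, hjac', hsk']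
    have hC := hhalf (f (τ (S.bracket (B.basis y) (S.bracket (B.basis x) (B.basis y)))))
    rcases zmod_two_cases (B.par x) with h | h <;>
    simp only [h, h₂, zmod_two_one_add_one, zero_add, koszulSign_zero_left,
      koszulSign_zero_right, koszulSign_one_one]
    · linear_combination (norm := module) hC
    · linear_combination (norm := module) -hC
  -- Here `y = x` is odd, and Jacobi gives `[[x, x], z] = 2[x, [x, z]]`.
  · specialize hxzy h₂
    specialize hzxy h₂ h₂
    simp only [rewriteTerm, swapCoeff, remainder, if_neg h₂.ne', if_true,
      add_mul, mul_add, smul_mul_assoc, mul_smul_comm, map_add, map_smul, ← mul_assoc, zero_smul,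
      zero_add] at *
    rw [hxzy, hzxy, l1, l3]
    have hC := hhalf (f (τ (S.bracket (B.basis x) (S.bracket (B.basis x) (B.basis z)))))
    rcases zmod_two_cases (B.par z) with h | h <;>
    simp only [h, h₁, zmod_two_one_add_one, add_zero, koszulSign_zero_left,
      koszulSign_zero_right, koszulSign_one_one] at hjac' ⊢ <;>
    linear_combination (norm := module) (-(2 : k)⁻¹) • hjac' - hC
  -- Here `x = y = z` is odd: `½[x, x]x` and `½x[x, x]` must agree, which is the cube axiom.
  · have h0 := S.odd_cube (B.basis x) (h₁ ▸ B.mem x)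
    simp only [rewriteTerm, swapCoeff, remainder, if_true, smul_mul_assoc, mul_smul_comm,
      map_smul, zero_smul, zero_add]
    rw [l3, h0]
    simp [h₁, zmod_two_one_add_one]

end HomogeneousBasis
end LieSuperalgebra

/-! ### Confluence of the rewriting system. -/

namespace LieSuperalgebra

open Module

variable {k : Type*} {V : Type*} [Field k] [AddCommGroup V] [Module k V]

namespace HomogeneousBasis

variable {S : LieSuperalgebra k V} {ι : Type*} {B : S.HomogeneousBasis ι} [LinearOrder ι]

local notation "τ" => TensorAlgebra.ι k

theorem linear_rewriteTerm_congr {M : Type*} [AddCommGroup M] [Module k M]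
    (f g : TensorAlgebra k V →ₗ[k] M) {i j : ι} (hr : B.Reducible i j)
    (hι : ∀ l, f (τ (B.basis l)) = g (τ (B.basis l)))
    (hswap : j < i → f (τ (B.basis j) * τ (B.basis i)) = g (τ (B.basis j) * τ (B.basis i))) :
    f (B.rewriteTerm i j) = g (B.rewriteTerm i j) := by
  have h : f ∘ₗ τ = g ∘ₗ τ := B.basis.ext hι
  have h' : f (τ (B.remainder i j)) = g (τ (B.remainder i j)) := LinearMap.congr_fun h _
  rw [rewriteTerm, map_add, map_add, map_smul, map_smul, h']
  rcases hr with hr | ⟨rfl, -⟩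
  · rw [hswap hr]
  · simp [swapCoeff]

theorem reducible_of_lt_of_reducible {x y z : ι} (h : y < x) (h' : B.Reducible y z) :
    B.Reducible x z := by
  rcases h' with h' | ⟨rfl, -⟩
  exacts [Or.inl (h'.trans h), Or.inl h]

theorem reducible_of_reducible_of_lt {x y z : ι} (h : B.Reducible x y) (h' : z < y) :
    B.Reducible x z := by
  rcases h with h | ⟨rfl, -⟩
  exacts [Or.inl (h'.trans h), Or.inl h']

section Confluence

variable {n : ℕ} {w : List ι} (hn : w.length = n) (hlow : B.ReductionsAgree fun w => w.length < n)
  (htop : B.ReductionsAgree fun w' => w'.length = n ∧ w'.inversionCount < w.inversionCount)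

include hn hlow htop

/-- Reductions at disjoint places commute. Once one has been applied, the words that arise are
shorter or have fewer inversions, so by hypothesis the other may be applied to each; both orders
give the same double substitution. -/
theorem confluent_disjoint {u m v : List ι} {i j i' j' : ι}
    (hw : w = u ++ i :: j :: (m ++ i' :: j' :: v)) (h : B.Reducible i j)
    (h' : B.Reducible i' j') :
    B.normalContext u (m ++ i' :: j' :: v) (B.rewriteTerm i j) =
      B.normalContext (u ++ i :: j :: m) v (B.rewriteTerm i' j') := by
  have hlen : u.length + m.length + v.length + 4 = n := by
    rw [← hn, hw]; simp only [List.length_append, List.length_cons]; omega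
  let g (s : TensorAlgebra k V) : TensorAlgebra k V →ₗ[k] (List ι →₀ k) :=
    B.normalContext u v ∘ₗ LinearMap.mulLeft k (s * B.tensorWord m)
  let g' (t : TensorAlgebra k V) : TensorAlgebra k V →ₗ[k] (List ι →₀ k) :=
    B.normalContext u v ∘ₗ LinearMap.mulRight k (B.tensorWord m * t)
  have hgg' : ∀ s t, g s t = g' t s := fun s t => by simp [g, g', mul_assoc]
  have e1 : ∀ t, B.normalContext u (m ++ i' :: j' :: v) t =
      g' (τ (B.basis i') * τ (B.basis j')) t := fun t => by
    simp [g', normalContext_apply, mul_assoc]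
  have e2 : ∀ t, B.normalContext (u ++ i :: j :: m) v t =
      g (τ (B.basis i) * τ (B.basis j)) t := fun t => by
    simp [g, normalContext_apply, mul_assoc]
  have a1 : g' (τ (B.basis i') * τ (B.basis j')) (B.rewriteTerm i j) =
      g' (B.rewriteTerm i' j') (B.rewriteTerm i j) := by
    refine linear_rewriteTerm_congr _ _ h (fun l => ?_) (fun hij => ?_)
    · have := hlow (u ++ l :: m) i' j' v
        (by simp only [List.length_append, List.length_cons]; omega) h'
      rw [← normalContext_pair] at this
      simpa [g', normalContext_apply, mul_assoc] using this
    · have := htop (u ++ j :: i :: m) i' j' v ⟨by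
          simp only [List.length_append, List.length_cons]; omega, by
          rw [hw]; simpa using List.inversionCount_swap_lt u (m ++ i' :: j' :: v) hij⟩ h'
      rw [← normalContext_pair] at this
      simpa [g', normalContext_apply, mul_assoc] using this
  have a2 : g (τ (B.basis i) * τ (B.basis j)) (B.rewriteTerm i' j') =
      g (B.rewriteTerm i j) (B.rewriteTerm i' j') := by
    refine linear_rewriteTerm_congr _ _ h' (fun l => ?_) (fun hij => ?_)
    · have := hlow u i j (m ++ l :: v)
        (by simp only [List.length_append, List.length_cons]; omega) h
      rw [← normalContext_pair] at this
      simpa [g, normalContext_apply, mul_assoc] using this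
    · have := htop u i j (m ++ j' :: i' :: v) ⟨by
          simp only [List.length_append, List.length_cons]; omega, by
          rw [hw]; simpa using List.inversionCount_swap_lt (u ++ i :: j :: m) v hij⟩ h
      rw [← normalContext_pair] at this
      simpa [g, normalContext_apply, mul_assoc] using this
  rw [e1, e2, a1, a2, hgg']

theorem confluent_overlap (h2 : (2 : k) ≠ 0) {u v : List ι} {x y z : ι}
    (hw : w = u ++ x :: y :: z :: v) (h : B.Reducible x y) (h' : B.Reducible y z) :
    B.normalContext u (z :: v) (B.rewriteTerm x y) =
      B.normalContext (u ++ [x]) v (B.rewriteTerm y z) := by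
  have hlen : u.length + v.length + 3 = n := by
    rw [← hn, hw]; simp only [List.length_append, List.length_cons]; omega
  have hfst : ∀ {a b c}, n = (u ++ a :: b :: c :: v).length := by
    intros; simp only [List.length_append, List.length_cons]; omega
  have lt1 : ∀ {a b c}, b < a → (u ++ b :: a :: c :: v).inversionCount <
      (u ++ a :: b :: c :: v).inversionCount := fun hab => List.inversionCount_swap_lt _ _ hab
  have lt2 : ∀ {a b c}, c < b → (u ++ a :: c :: b :: v).inversionCount <
      (u ++ a :: b :: c :: v).inversionCount := fun {a b c} hab => by
    simpa using List.inversionCount_swap_lt (u ++ [a]) v hab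
  have red1 : ∀ {a b c}, B.Reducible a b →
      (u ++ a :: b :: c :: v).inversionCount < w.inversionCount →
      B.normalContext u v (τ (B.basis a) * τ (B.basis b) * τ (B.basis c)) =
        B.normalContext u v (B.rewriteTerm a b * τ (B.basis c)) := by
    intro a b c hr hlt
    have := htop u a b (c :: v) ⟨hfst.symm, hlt⟩ hr
    rwa [← normalContext_pair, normalContext_cons, normalContext_cons] at this
  have red2 : ∀ {a b c}, B.Reducible b c →
      (u ++ a :: b :: c :: v).inversionCount < w.inversionCount →
      B.normalContext u v (τ (B.basis a) * τ (B.basis b) * τ (B.basis c)) =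
        B.normalContext u v (τ (B.basis a) * B.rewriteTerm b c) := by
    intro a b c hr hlt
    have := htop (u ++ [a]) b c v ⟨by
      simp only [List.length_append, List.length_cons, List.length_nil]; omega, by simpa using hlt⟩ hr
    rwa [← normalContext_pair, normalContext_concat, normalContext_concat, ← mul_assoc] at this
  rw [normalContext_cons, normalContext_concat]
  refine overlap h2 _ ?_ h h' ?_ ?_ ?_ ?_
  · intro s t a b ha hb
    have := normalContext_relator h2 hlow (u := u) (v := v) (by omega) s t a b ha hb
    rwa [relator, map_sub, map_add, map_smul, sub_eq_zero] at this
  · intro hyx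
    exact red2 (reducible_of_lt_of_reducible hyx h') (hw ▸ lt1 hyx)
  · intro hyx hzx
    exact red1 h' (hw ▸ (lt2 hzx).trans (lt1 hyx))
  · intro hzy
    exact red1 (reducible_of_reducible_of_lt h hzy) (hw ▸ lt2 hzy)
  · intro hzy hzx
    exact red2 h (hw ▸ (lt1 hzx).trans (lt2 hzy))

theorem confluent (h2 : (2 : k) ≠ 0) {u v a v' : List ι} {i j i' j' : ι}
    (hw : w = u ++ i :: j :: v) (ha : i :: j :: v = a ++ i' :: j' :: v')
    (h : B.Reducible i j) (h' : B.Reducible i' j') :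
    B.normalContext u v (B.rewriteTerm i j) =
      B.normalContext (u ++ a) v' (B.rewriteTerm i' j') := by
  match a, ha with
  | [], ha =>
    simp only [List.nil_append, List.cons.injEq] at ha
    obtain ⟨rfl, rfl, rfl⟩ := ha
    simp
  | [c], ha =>
    simp only [List.cons_append, List.nil_append, List.cons.injEq] at ha
    obtain ⟨rfl, rfl, rfl⟩ := ha
    exact confluent_overlap hn hlow htop h2 hw h h'
  | c :: d :: m, ha =>
    simp only [List.cons_append, List.cons.injEq] at ha
    obtain ⟨rfl, rfl, rfl⟩ := ha
    exact confluent_disjoint hn hlow htop hw h h'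

theorem normalWord_eq_of_confluent (h2 : (2 : k) ≠ 0) {u v : List ι} {i j : ι}
    (hw : w = u ++ i :: j :: v) (h : B.Reducible i j) :
    B.normalWord w = B.normalContext u v (B.rewriteTerm i j) := by
  rcases B.normalWord_cases w with ⟨u', i', j', v', hw', h', heq⟩ | ⟨hno, -⟩
  · rw [heq]
    -- `normalWord` reduces at an unspecified place, which lies to the left or to the right of the
    -- given one.
    rcases List.append_eq_append_iff.mp (hw.symm.trans hw') with ⟨a, rfl, ha⟩ | ⟨a, rfl, ha⟩
    · exact (confluent hn hlow htop h2 hw ha h h').symm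
    · exact confluent hn hlow htop h2 hw' ha h' h
  · exact absurd h (hno u i j v hw)

end Confluence

/-- Induction on the length and, for words of a fixed length, on the number of inversions: this is
the measure for which the confluence lemmas need smaller cases. -/
theorem reductionsAgree (h2 : (2 : k) ≠ 0) : B.ReductionsAgree fun _ => True := by
  have main : ∀ n, B.ReductionsAgree fun w => w.length < n := by
    intro n
    induction n with
    | zero => intro u i j v h; simp at h
    | succ n ih =>
      have key : ∀ m, B.ReductionsAgree fun w => w.length = n ∧ w.inversionCount < m := by
        intro m
        induction m with
        | zero => intro u i j v h; simp at h
        | succ m ihm =>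
          intro u i j v h hr
          rcases Nat.lt_succ_iff_lt_or_eq.mp h.2 with h' | h'
          · exact ihm u i j v ⟨h.1, h'⟩ hr
          · subst h'
            exact normalWord_eq_of_confluent h.1 ih ihm h2 rfl hr
      intro u i j v h hr
      rcases Nat.lt_succ_iff_lt_or_eq.mp h with h' | h'
      · exact ih u i j v h' hr
      · exact key _ u i j v ⟨h', Nat.lt_succ_self _⟩ hr
  intro u i j v _ hr
  exact main _ u i j v (Nat.lt_succ_self _) hr

/-- Between words this is compatibility of the normal form with the relations; it extends by
linearity, first in the right factor and then in the left one. -/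
theorem normalTensor_relator (h2 : (2 : k) ≠ 0) (s t : ZMod 2) (x y : V) (hx : x ∈ S.part s)
    (hy : y ∈ S.part t) (a c : TensorAlgebra k V) :
    B.normalTensor (a * S.relator s t x y * c) = 0 := by
  have h : ∀ u v, B.normalTensor (B.tensorWord u * S.relator s t x y * B.tensorWord v) = 0 := by
    intro u v
    have H : B.ReductionsAgree fun w => w.length < u.length + v.length + 3 :=
      fun u i j v _ hr => reductionsAgree h2 u i j v trivial hr
    have := normalContext_relator h2 H (u := u) (v := v) (by omega) s t x y hx hy
    rwa [normalContext_apply, ← mul_assoc] at this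
  have h1 : ∀ u, B.normalTensor ∘ₗ LinearMap.mulLeft k (B.tensorWord u * S.relator s t x y) = 0 :=
    fun u => B.tensorAlgebra_ext fun v => by
      rw [LinearMap.comp_apply, LinearMap.mulLeft_apply]
      exact h u v
  have h3 : B.normalTensor ∘ₗ LinearMap.mulRight k (S.relator s t x y * c) = 0 :=
    B.tensorAlgebra_ext fun u => by
      have := LinearMap.congr_fun (h1 u) c
      rwa [LinearMap.comp_apply, LinearMap.mulLeft_apply, mul_assoc] at this
  have := LinearMap.congr_fun h3 a
  rwa [LinearMap.comp_apply, LinearMap.mulRight_apply, ← mul_assoc] at this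

end HomogeneousBasis
end LieSuperalgebra

/-! ### The Poincaré–Birkhoff–Witt basis of the enveloping algebra. -/

namespace LieSuperalgebra

open Module

variable {k : Type*} {V : Type*} [Field k] [AddCommGroup V] [Module k V]

section Env

variable (S : LieSuperalgebra k V)

theorem mkAlgHom_ι (x : V) : RingQuot.mkAlgHom k S.EnvRel (TensorAlgebra.ι k x) = S.envι x := rfl

theorem envι_mul_envι {s t : ZMod 2} {x y : V} (hx : x ∈ S.part s) (hy : y ∈ S.part t) :
    S.envι x * S.envι y =
      koszulSign k s t • (S.envι y * S.envι x) + S.envι (S.bracket x y) := by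
  have := RingQuot.mkAlgHom_rel k (EnvRel.comm s t x y hx hy)
  simp only [map_mul, map_add, map_smul, mkAlgHom_ι] at this
  exact this

theorem mkAlgHom_toLinearMap_surjective :
    Function.Surjective (RingQuot.mkAlgHom k S.EnvRel).toLinearMap :=
  RingQuot.mkAlgHom_surjective k S.EnvRel

end Env

namespace HomogeneousBasis

variable {S : LieSuperalgebra k V} {ι : Type*} (B : S.HomogeneousBasis ι)

local notation "τ" => TensorAlgebra.ι k

/-- The word `w` in the basis, as an element of the enveloping algebra. -/
noncomputable def envWord (w : List ι) : S.Env := (w.map fun i => S.envι (B.basis i)).prod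

@[simp] theorem envWord_nil : B.envWord [] = 1 := rfl

@[simp] theorem envWord_cons (i : ι) (w : List ι) :
    B.envWord (i :: w) = S.envι (B.basis i) * B.envWord w := by
  simp [envWord]

@[simp] theorem envWord_append (u w : List ι) :
    B.envWord (u ++ w) = B.envWord u * B.envWord w := by
  simp [envWord]

theorem mkAlgHom_tensorWord (w : List ι) :
    RingQuot.mkAlgHom k S.EnvRel (B.tensorWord w) = B.envWord w := by
  induction w with
  | nil => simp
  | cons i w ih => rw [tensorWord_cons, map_mul, ih, mkAlgHom_ι, envWord_cons]

/-- The linear map that evaluates combinations of words in the enveloping algebra. -/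
noncomputable def evalWords : (List ι →₀ k) →ₗ[k] S.Env := Finsupp.linearCombination k B.envWord

@[simp] theorem evalWords_single (w : List ι) (c : k) :
    B.evalWords (Finsupp.single w c) = c • B.envWord w := by
  simp [evalWords]

/-- The parity of a word. -/
def parity (w : List ι) : ZMod 2 := (w.map B.par).sum

@[simp] theorem parity_nil : B.parity [] = 0 := rfl

@[simp] theorem parity_cons (i : ι) (w : List ι) :
    B.parity (i :: w) = B.par i + B.parity w := by
  simp [parity]

@[simp] theorem parity_append (u w : List ι) :
    B.parity (u ++ w) = B.parity u + B.parity w := by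
  simp [parity]

variable [LinearOrder ι]

/-- The words of the Poincaré–Birkhoff–Witt basis: sorted, without repeated odd letters. -/
def Admissible (w : List ι) : Prop := w.Pairwise fun i j => i < j ∨ i = j ∧ B.par i = 0

theorem not_reducible_iff {i j : ι} : ¬ B.Reducible i j ↔ i < j ∨ i = j ∧ B.par i = 0 := by
  unfold Reducible
  rcases lt_trichotomy i j with h | h | h
  · simp [h, h.not_gt, h.ne]
  · subst h
    rcases zmod_two_cases (B.par i) with h | h <;> simp [h]
  · simp [h, h.not_gt, h.ne']

/-- The order condition is transitive, so it suffices to test adjacent letters. -/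
theorem admissible_iff {w : List ι} :
    B.Admissible w ↔ ∀ u i j v, w = u ++ i :: j :: v → ¬ B.Reducible i j := by
  constructor
  · rintro h u i j v rfl
    rw [Admissible, List.pairwise_append] at h
    exact B.not_reducible_iff.mpr ((List.pairwise_cons.mp h.2.1).1 j (by simp))
  · intro h
    have : IsTrans ι fun i j => i < j ∨ i = j ∧ B.par i = 0 := ⟨by
      rintro a b c (h | ⟨rfl, h⟩) (h' | ⟨rfl, h'⟩)
      exacts [Or.inl (h.trans h'), Or.inl h, Or.inl h', Or.inr ⟨rfl, h⟩]⟩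
    rw [Admissible, ← List.isChain_iff_pairwise, List.isChain_iff_forall_rel_of_append_cons_cons]
    intro i j u v hw
    exact B.not_reducible_iff.mp (h u i j v hw)

theorem wordInduction {P : List ι → Prop} (irreducible : ∀ w, B.Admissible w → P w)
    (reducible : ∀ u i j v, B.Reducible i j → (j < i → P (u ++ j :: i :: v)) →
      (∀ l, P (u ++ l :: v)) → P (u ++ i :: j :: v)) (w : List ι) : P w := by
  have main : ∀ n m w, w.length = n → w.inversionCount = m → P w := by
    intro n
    induction n using Nat.strong_induction_on with
    | _ n ihn =>
      intro m
      induction m using Nat.strong_induction_on with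
      | _ m ihm =>
        intro w hn hm
        by_cases h : B.Admissible w
        · exact irreducible w h
        · rw [admissible_iff] at h
          push Not at h
          obtain ⟨u, i, j, v, rfl, hr⟩ := h
          simp only [List.length_append, List.length_cons] at hn
          refine reducible u i j v hr (fun hij => ?_) (fun l => ?_)
          · refine ihm _ (hm ▸ List.inversionCount_swap_lt u v hij) _ ?_ rfl
            simp only [List.length_append, List.length_cons]; omega
          · refine ihn _ ?_ _ _ rfl rfl
            simp only [List.length_append, List.length_cons]; omega
  exact main _ _ w rfl rfl

theorem normalWord_of_admissible {w : List ι} (h : B.Admissible w) :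
    B.normalWord w = Finsupp.single w 1 := by
  rcases B.normalWord_cases w with ⟨u, i, j, v, hw, hr, -⟩ | h'
  · exact absurd hr (B.admissible_iff.mp h u i j v hw)
  · exact h'.2

variable [NeZero (2 : k)]

variable {B} in
theorem normalWord_of_reducible (u : List ι) {i j : ι} (v : List ι) (h : B.Reducible i j) :
    B.normalWord (u ++ i :: j :: v) = B.normalContext u v (B.rewriteTerm i j) :=
  reductionsAgree (NeZero.ne 2) u i j v trivial h

theorem mkAlgHom_rewriteTerm {i j : ι} (h : B.Reducible i j) :
    RingQuot.mkAlgHom k S.EnvRel (B.rewriteTerm i j) =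
      S.envι (B.basis i) * S.envι (B.basis j) := by
  have hm := S.envι_mul_envι (B.mem i) (B.mem j)
  rw [rewriteTerm, map_add, map_smul, map_mul, mkAlgHom_ι, mkAlgHom_ι, mkAlgHom_ι]
  rcases h with h | ⟨rfl, h⟩
  · rw [swapCoeff, remainder, if_neg h.ne', if_neg h.ne', hm]
  · rw [swapCoeff, remainder, if_pos rfl, if_pos rfl, zero_smul, zero_add, map_smul,
      inv_smul_eq_iff₀ (NeZero.ne 2), two_smul]
    rw [h] at hm
    rw [koszulSign_one_one] at hm
    linear_combination (norm := module) -hm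

/-- Each rewriting rule is an identity in the enveloping algebra, so reduction does not change the
value of a word. -/
theorem evalWords_normalWord (w : List ι) : B.evalWords (B.normalWord w) = B.envWord w := by
  induction w using B.wordInduction with
  | irreducible w h => simp [B.normalWord_of_admissible h]
  | reducible u i j v hr hswap hι =>
    rw [normalWord_of_reducible u v hr]
    let g : TensorAlgebra k V →ₗ[k] S.Env :=
      LinearMap.mulLeft k (B.envWord u) ∘ₗ LinearMap.mulRight k (B.envWord v) ∘ₗ
        (RingQuot.mkAlgHom k S.EnvRel).toLinearMap
    have hg : ∀ t, g t = B.envWord u * (RingQuot.mkAlgHom k S.EnvRel t * B.envWord v) :=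
      fun t => rfl
    have := linear_rewriteTerm_congr (B.evalWords ∘ₗ B.normalContext u v) g hr
      (fun l => by
        have := hι l
        rw [← List.singleton_append, ← List.append_assoc, ← normalContext_tensorWord] at this
        rw [hg, mkAlgHom_ι]
        simpa [mul_assoc] using this)
      (fun hji => by
        have := hswap hji
        rw [← normalContext_pair] at this
        rw [LinearMap.comp_apply, hg, map_mul (RingQuot.mkAlgHom k S.EnvRel), mkAlgHom_ι, mkAlgHom_ι]
        simpa [mul_assoc] using this)
    rw [LinearMap.comp_apply] at this
    rw [this, hg, B.mkAlgHom_rewriteTerm hr]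
    simp [mul_assoc]

theorem normalWord_mem_supported (w : List ι) : B.normalWord w ∈ Finsupp.supported k k
    {v | B.Admissible v ∧ v.length ≤ w.length ∧ B.parity v = B.parity w} := by
  induction w using B.wordInduction with
  | irreducible w h =>
    rw [B.normalWord_of_admissible h]
    exact Finsupp.single_mem_supported k 1 ⟨h, le_rfl, rfl⟩
  | reducible u i j v hr hswap hι =>
    rw [normalWord_of_reducible u v hr, rewriteTerm, map_add, map_smul, normalContext_pair,
      normalContext_ι]
    refine Submodule.add_mem _ ?_ (Submodule.sum_mem _ fun l hl => Submodule.smul_mem _ _ ?_)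
    · rcases hr with hr | ⟨rfl, -⟩
      · refine Submodule.smul_mem _ _ (Finsupp.supported_mono ?_ (hswap hr))
        rintro w ⟨h1, h2, h3⟩
        refine ⟨h1, by simpa using h2, ?_⟩
        rw [h3]
        simp only [parity_append, parity_cons]
        ring
      · simp [swapCoeff]
    · refine Finsupp.supported_mono ?_ (hι l)
      rintro w ⟨h1, h2, h3⟩
      refine ⟨h1, ?_, ?_⟩
      · simp only [List.length_append, List.length_cons] at h2 ⊢
        omega
      · rw [h3]
        have := B.par_eq_of_repr_ne_zero (B.remainder_mem i j) (Finsupp.mem_support_iff.mp hl)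
        simp only [parity_append, parity_cons, this]
        ring

/-- The factors `x` and `y` stay arbitrary in the induction: closing the relation under
multiplication only enlarges the context. -/
theorem normalTensor_eq_of_rel {a c : TensorAlgebra k V} (h : RingQuot.Rel S.EnvRel a c)
    (x y : TensorAlgebra k V) :
    B.normalTensor (x * a * y) = B.normalTensor (x * c * y) := by
  induction h generalizing x y with
  | of h =>
    obtain ⟨s, t, a, c, ha, hc⟩ := h
    have := normalTensor_relator (B := B) (NeZero.ne 2) s t a c ha hc x y
    rw [relator, mul_sub, sub_mul, map_sub, sub_eq_zero] at this
    exact this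
  | add_left _ ih => simp only [mul_add, add_mul, map_add, ih]
  | @mul_left a c d _ ih =>
    have := ih x (d * y)
    simpa only [mul_assoc] using this
  | @mul_right a c d _ ih =>
    have := ih (x * a) y
    simpa only [mul_assoc] using this

theorem normalTensor_eq_of_mkAlgHom_eq {a c : TensorAlgebra k V}
    (h : RingQuot.mkAlgHom k S.EnvRel a = RingQuot.mkAlgHom k S.EnvRel c) :
    B.normalTensor a = B.normalTensor c := by
  have h' : RingQuot.mkRingHom S.EnvRel a = RingQuot.mkRingHom S.EnvRel c := by
    rw [← RingQuot.mkAlgHom_coe k]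
    exact h
  simp only [RingQuot.mkRingHom_def, RingHom.coe_mk, MonoidHom.coe_mk, OneHom.coe_mk,
    RingQuot.mk.injEq] at h'
  -- Equality in the quotient is the equivalence relation generated by `RingQuot.Rel`, so it can be
  -- handled one relation at a time.
  have := Quot.eqvGen_exact h'
  clear h h'
  induction this with
  | rel a c h => simpa using B.normalTensor_eq_of_rel h 1 1
  | refl => rfl
  | symm a c _ ih => exact ih.symm
  | trans a c d _ _ ih ih' => exact ih.trans ih'

/-- The normal form map on the enveloping algebra. -/
noncomputable def normalEnv : S.Env →ₗ[k] (List ι →₀ k) :=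
  (LinearMap.ker (RingQuot.mkAlgHom k S.EnvRel).toLinearMap).liftQ B.normalTensor
    (fun t ht => by
      rw [LinearMap.mem_ker] at ht ⊢
      rw [← map_zero B.normalTensor]
      exact B.normalTensor_eq_of_mkAlgHom_eq (ht.trans (map_zero _).symm)) ∘ₗ
  (LinearMap.quotKerEquivOfSurjective _
    (S.mkAlgHom_toLinearMap_surjective)).symm.toLinearMap

theorem normalEnv_mkAlgHom (t : TensorAlgebra k V) :
    B.normalEnv (RingQuot.mkAlgHom k S.EnvRel t) = B.normalTensor t := by
  have h : (LinearMap.quotKerEquivOfSurjective _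
      (S.mkAlgHom_toLinearMap_surjective)).symm (RingQuot.mkAlgHom k S.EnvRel t) =
      Submodule.Quotient.mk t := by
    rw [LinearEquiv.symm_apply_eq]
    rfl
  rw [normalEnv, LinearMap.comp_apply, LinearEquiv.coe_coe, h]
  exact Submodule.liftQ_apply _ _ _

theorem normalEnv_envWord (w : List ι) : B.normalEnv (B.envWord w) = B.normalWord w := by
  rw [← mkAlgHom_tensorWord, normalEnv_mkAlgHom, normalTensor_tensorWord]

theorem evalWords_normalEnv (u : S.Env) : B.evalWords (B.normalEnv u) = u := by
  obtain ⟨t, rfl⟩ := RingQuot.mkAlgHom_surjective k S.EnvRel u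
  have : B.evalWords ∘ₗ B.normalTensor = (RingQuot.mkAlgHom k S.EnvRel).toLinearMap := by
    refine B.tensorAlgebra_ext fun w => ?_
    rw [LinearMap.comp_apply, normalTensor_tensorWord, evalWords_normalWord]
    exact (B.mkAlgHom_tensorWord w).symm
  rw [normalEnv_mkAlgHom]
  exact LinearMap.congr_fun this t

end HomogeneousBasis

/-- An enveloping algebra `U` of a Lie superalgebra, given by a linear map from the Lie
superalgebra which satisfies the defining relations and by the coordinate map with respect to the
Poincaré–Birkhoff–Witt basis of admissible words. -/
structure PBWAlgebra {S : LieSuperalgebra k V} {ι : Type*} [LinearOrder ι]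
    (B : S.HomogeneousBasis ι) (U : Type*) [Ring U] [Algebra k U] where
  incl : V →ₗ[k] U
  incl_mul_incl : ∀ {s t : ZMod 2} {x y : V}, x ∈ S.part s → y ∈ S.part t →
    incl x * incl y = koszulSign k s t • (incl y * incl x) + incl (S.bracket x y)
  normal : U →ₗ[k] (List ι →₀ k)
  normal_of_admissible : ∀ {w : List ι}, B.Admissible w →
    normal (w.map fun i => incl (B.basis i)).prod = Finsupp.single w 1
  normal_mem_supported : ∀ w : List ι, normal (w.map fun i => incl (B.basis i)).prod ∈
    Finsupp.supported k k
      {v | B.Admissible v ∧ v.length ≤ w.length ∧ B.parity v = B.parity w}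
  eval_normal : ∀ u : U,
    Finsupp.linearCombination k (fun w : List ι => (w.map fun i => incl (B.basis i)).prod)
      (normal u) = u

/-- The Poincaré–Birkhoff–Witt theorem for Lie superalgebras. -/
noncomputable def HomogeneousBasis.envPBW {S : LieSuperalgebra k V} {ι : Type*} [LinearOrder ι]
    [NeZero (2 : k)] (B : S.HomogeneousBasis ι) : PBWAlgebra B S.Env where
  incl := S.envι
  incl_mul_incl := S.envι_mul_envι
  normal := B.normalEnv
  normal_of_admissible h := (B.normalEnv_envWord _).trans (B.normalWord_of_admissible h)
  normal_mem_supported w := by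
    have := B.normalWord_mem_supported w
    rwa [← normalEnv_envWord] at this
  eval_normal := B.evalWords_normalEnv

end LieSuperalgebra

/-! ### The length filtration and leading terms of supercommutators. -/

namespace LieSuperalgebra

open Module

variable {k : Type*} {V : Type*} [Field k] [AddCommGroup V] [Module k V]

section Deletions

variable {S : LieSuperalgebra k V} {ι : Type*} (B : S.HomogeneousBasis ι)

/-- The ways to move a letter of a word to its end: the sign that arises, the letter, and the word
that remains. -/
def HomogeneousBasis.deletions : List ι → List (k × ι × List ι)
  | [] => []
  | i :: w => (koszulSign k (B.par i) (B.parity w), i, w) ::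
      (deletions w).map fun d => (d.1, d.2.1, i :: d.2.2)

namespace HomogeneousBasis

theorem map_deletions (w : List ι) : (B.deletions w).map (fun d => d.2.1) = w := by
  induction w with
  | nil => rfl
  | cons i w ih => simpa [deletions, Function.comp_def] using ih

theorem deletions_perm {w : List ι} {d : k × ι × List ι} (hd : d ∈ B.deletions w) :
    (d.2.1 :: d.2.2).Perm w := by
  induction w generalizing d with
  | nil => simp [deletions] at hd
  | cons i w ih =>
    rw [deletions, List.mem_cons, List.mem_map] at hd
    rcases hd with rfl | ⟨d, hd, rfl⟩
    · rfl
    · exact (List.Perm.swap i d.2.1 d.2.2).trans ((ih hd).cons i)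

theorem deletions_sublist {w : List ι} {d : k × ι × List ι} (hd : d ∈ B.deletions w) :
    d.2.2.Sublist w := by
  induction w generalizing d with
  | nil => simp [deletions] at hd
  | cons i w ih =>
    rw [deletions, List.mem_cons, List.mem_map] at hd
    rcases hd with rfl | ⟨d, hd, rfl⟩
    · exact List.sublist_cons_self _ _
    · exact (ih hd).cons_cons i

theorem deletions_sign {w : List ι} {d : k × ι × List ι} (hd : d ∈ B.deletions w) :
    ∃ t, d.1 = koszulSign k (B.par d.2.1) t := by
  induction w generalizing d with
  | nil => simp [deletions] at hd
  | cons i w ih =>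
    rw [deletions, List.mem_cons, List.mem_map] at hd
    rcases hd with rfl | ⟨d, hd, rfl⟩
    · exact ⟨_, rfl⟩
    · obtain ⟨t, ht⟩ := ih hd
      exact ⟨t, ht⟩

end HomogeneousBasis
end Deletions

section Filtration

variable {S : LieSuperalgebra k V} {ι : Type*} [LinearOrder ι] {B : S.HomogeneousBasis ι}
  {U : Type*} [Ring U] [Algebra k U] (P : PBWAlgebra B U)

namespace PBWAlgebra

/-- The product of the letters of a word in the enveloping algebra. -/
noncomputable def word (w : List ι) : U := (w.map fun i => P.incl (B.basis i)).prod

@[simp] theorem word_nil : P.word [] = 1 := rfl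

@[simp] theorem word_cons (i : ι) (w : List ι) :
    P.word (i :: w) = P.incl (B.basis i) * P.word w := by
  simp [word]

@[simp] theorem word_append (u w : List ι) : P.word (u ++ w) = P.word u * P.word w := by
  simp [word]

theorem normal_word {w : List ι} (h : B.Admissible w) : P.normal (P.word w) = Finsupp.single w 1 :=
  P.normal_of_admissible h

theorem sum_normal (u : U) : (P.normal u).sum (fun w c => c • P.word w) = u :=
  P.eval_normal u

/-- The span of the words of length less than `n`. -/
def filtration (n : ℕ) : Submodule k U := Submodule.span k {u | ∃ w, w.length < n ∧ u = P.word w}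

theorem word_mem_filtration {w : List ι} {n : ℕ} (h : w.length < n) :
    P.word w ∈ P.filtration n :=
  Submodule.subset_span ⟨w, h, rfl⟩

theorem filtration_mono {m n : ℕ} (h : m ≤ n) : P.filtration m ≤ P.filtration n :=
  Submodule.span_mono fun _ ⟨w, hw, e⟩ => ⟨w, hw.trans_le h, e⟩

theorem filtration_zero : P.filtration 0 = ⊥ := by
  simp [filtration]

/-- The bounds on lengths are strict: factors of lengths at most `m - 1` and `n - 1` have a product
of length at most `m + n - 2`, whence the `l + 1`. -/
theorem mul_mem_filtration {m n l : ℕ} (h : m + n ≤ l + 1) {a c : U} (ha : a ∈ P.filtration m)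
    (hc : c ∈ P.filtration n) : a * c ∈ P.filtration l := by
  have := Submodule.mul_mem_mul ha hc
  rw [filtration, filtration, Submodule.span_mul_span] at this
  refine Submodule.span_le.mpr ?_ this
  rintro _ ⟨_, ⟨w, hw, rfl⟩, _, ⟨w', hw', rfl⟩, rfl⟩
  change P.word w * P.word w' ∈ _
  rw [← word_append]
  exact P.word_mem_filtration (by rw [List.length_append]; omega)

theorem incl_mem_filtration (x : V) : P.incl x ∈ P.filtration 2 := by
  rw [← B.basis.linearCombination_repr x, Finsupp.linearCombination_apply, Finsupp.sum, map_sum]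
  refine Submodule.sum_mem _ fun l _ => ?_
  rw [map_smul]
  refine Submodule.smul_mem _ _ ?_
  simpa using P.word_mem_filtration (w := [l]) (n := 2) (by simp)

theorem exists_mem_filtration (u : U) : ∃ n, u ∈ P.filtration n := by
  refine ⟨(P.normal u).support.sup List.length + 1, ?_⟩
  rw [← P.sum_normal u]
  refine Submodule.sum_mem _ fun w hw => Submodule.smul_mem _ _ (P.word_mem_filtration ?_)
  rw [P.sum_normal u]
  exact Nat.lt_succ_of_le (Finset.le_sup hw)

theorem length_lt_of_mem_filtration {n : ℕ} {u : U} (hu : u ∈ P.filtration n) {w : List ι}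
    (hw : P.normal u w ≠ 0) : w.length < n := by
  have : P.filtration n ≤ (Finsupp.supported k k {w : List ι | w.length < n}).comap P.normal := by
    refine Submodule.span_le.mpr ?_
    rintro _ ⟨v, hv, rfl⟩
    exact Finsupp.supported_mono (fun _ h => h.2.1.trans_lt hv) (P.normal_mem_supported v)
  exact this hu (Finsupp.mem_support_iff.mpr hw)

theorem admissible_of_normal_ne_zero {u : U} {w : List ι} (hw : P.normal u w ≠ 0) :
    B.Admissible w := by
  have : P.normal u ∈ Finsupp.supported k k {w : List ι | B.Admissible w} := by
    rw [← P.sum_normal u, Finsupp.sum, map_sum]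
    refine Submodule.sum_mem _ fun v _ => ?_
    rw [map_smul]
    exact Submodule.smul_mem _ _ (Finsupp.supported_mono (fun _ h => h.1) (P.normal_mem_supported v))
  exact this (Finsupp.mem_support_iff.mpr hw)

/-- The span of the words of parity `i`. -/
def parityPart (i : ZMod 2) : Submodule k U :=
  Submodule.span k {u | ∃ w, B.parity w = i ∧ u = P.word w}

theorem parity_of_normal_ne_zero {i : ZMod 2} {u : U} (hu : u ∈ P.parityPart i) {w : List ι}
    (hw : P.normal u w ≠ 0) : B.parity w = i := by
  have : P.parityPart i ≤
      (Finsupp.supported k k {w : List ι | B.parity w = i}).comap P.normal := by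
    refine Submodule.span_le.mpr ?_
    rintro _ ⟨v, hv, rfl⟩
    exact Finsupp.supported_mono (fun _ h => h.2.2.trans hv) (P.normal_mem_supported v)
  exact this hu (Finsupp.mem_support_iff.mpr hw)

/-- By the super Leibniz rule the adjoint action replaces one letter at a time by a vector, so it
does not lengthen words. -/
theorem commutator_mem_filtration {s : ZMod 2} {x : V} (hx : x ∈ S.part s) (w : List ι) :
    P.incl x * P.word w - koszulSign k s (B.parity w) • (P.word w * P.incl x) ∈
      P.filtration (w.length + 1) := by
  induction w with
  | nil => simp
  | cons i w ih =>
    have hxi := P.incl_mul_incl hx (B.mem i)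
    have : P.incl x * P.word (i :: w) -
        koszulSign k s (B.parity (i :: w)) • (P.word (i :: w) * P.incl x) =
        koszulSign k s (B.par i) • (P.incl (B.basis i) * (P.incl x * P.word w -
          koszulSign k s (B.parity w) • (P.word w * P.incl x))) +
        P.incl (S.bracket x (B.basis i)) * P.word w := by
      rw [word_cons, ← mul_assoc, hxi, HomogeneousBasis.parity_cons, koszulSign_add_right,
        mul_smul, mul_sub, add_mul, smul_sub, mul_smul_comm, smul_mul_assoc, mul_assoc, mul_assoc]
      abel
    rw [this]
    refine Submodule.add_mem _ (Submodule.smul_mem _ _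
      (P.mul_mem_filtration ?_ (P.incl_mem_filtration _) ih))
      (P.mul_mem_filtration (n := w.length + 1) ?_ (P.incl_mem_filtration _)
        (P.word_mem_filtration (Nat.lt_succ_self _)))
    all_goals rw [List.length_cons]; omega

/-- The leading part of the supercommutator of `x` with a word. -/
theorem commutator_sub_deletions_mem_filtration {s : ZMod 2} {x : V} (hx : x ∈ S.part s)
    (w : List ι) :
    P.incl x * P.word w - koszulSign k s (B.parity w) • (P.word w * P.incl x) -
      ((B.deletions w).map fun d => (koszulSign k s (B.parity d.2.2) * d.1) •
        (P.word d.2.2 * P.incl (S.bracket x (B.basis d.2.1)))).sum ∈ P.filtration w.length := by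
  induction w with
  | nil => simp [HomogeneousBasis.deletions]
  | cons i w ih =>
    have hxi := P.incl_mul_incl hx (B.mem i)
    have hlist : ((B.deletions w).map fun d =>
        (koszulSign k s (B.parity (i :: d.2.2)) * d.1) •
          (P.word (i :: d.2.2) * P.incl (S.bracket x (B.basis d.2.1)))).sum =
        koszulSign k s (B.par i) • (P.incl (B.basis i) *
          ((B.deletions w).map fun d => (koszulSign k s (B.parity d.2.2) * d.1) •
            (P.word d.2.2 * P.incl (S.bracket x (B.basis d.2.1)))).sum) := by
      rw [← List.sum_map_mul_left, List.smul_sum, List.map_map]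
      congr 1
      refine List.map_congr_left fun d _ => ?_
      rw [Function.comp_apply, word_cons, HomogeneousBasis.parity_cons, koszulSign_add_right,
        mul_smul_comm, smul_smul, mul_assoc, mul_assoc]
    -- Moving `[x, i]` to the end, behind `w`, costs only shorter words. The sign splits into that
    -- of `x` past `w` and that of `i` past `w`; the latter is the one stored in `deletions`.
    have hb := P.commutator_mem_filtration (S.bracket_mem _ _ _ _ hx (B.mem i)) w
    have : P.incl x * P.word (i :: w) -
        koszulSign k s (B.parity (i :: w)) • (P.word (i :: w) * P.incl x) -
        ((B.deletions (i :: w)).map fun d => (koszulSign k s (B.parity d.2.2) * d.1) •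
          (P.word d.2.2 * P.incl (S.bracket x (B.basis d.2.1)))).sum =
        koszulSign k s (B.par i) • (P.incl (B.basis i) * (P.incl x * P.word w -
          koszulSign k s (B.parity w) • (P.word w * P.incl x) -
          ((B.deletions w).map fun d => (koszulSign k s (B.parity d.2.2) * d.1) •
            (P.word d.2.2 * P.incl (S.bracket x (B.basis d.2.1)))).sum)) +
        (P.incl (S.bracket x (B.basis i)) * P.word w -
          koszulSign k (s + B.par i) (B.parity w) •
            (P.word w * P.incl (S.bracket x (B.basis i)))) := by
      rw [HomogeneousBasis.deletions, List.map_cons, List.sum_cons, List.map_map,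
        Function.comp_def, hlist, word_cons, ← mul_assoc, hxi, HomogeneousBasis.parity_cons,
        koszulSign_add_right, koszulSign_add_left,
        mul_smul, mul_sub, mul_sub, add_mul, smul_sub, smul_sub, mul_smul_comm, smul_mul_assoc,
        mul_assoc, mul_assoc]
      abel
    rw [this]
    refine Submodule.add_mem _ (Submodule.smul_mem _ _
      (P.mul_mem_filtration ?_ (P.incl_mem_filtration _) ih)) hb
    rw [List.length_cons]; omega

end PBWAlgebra
end Filtration
end LieSuperalgebra

/-! ### Leading words of supercentral elements. -/

namespace LieSuperalgebra

open Module

variable {k : Type*} {V : Type*} [Field k] [AddCommGroup V] [Module k V]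

variable {S : LieSuperalgebra k V} {ι : Type*} [LinearOrder ι] {B : S.HomogeneousBasis ι}
  {U : Type*} [Ring U] [Algebra k U] (P : PBWAlgebra B U)

/-- For each finite set of letters there are homogeneous elements whose brackets with these letters
involve larger letters only, and which have no common nonzero centralizing element. -/
def HomogeneousBasis.HasSeparatingShifts (B : S.HomogeneousBasis ι) : Prop :=
  ∀ F : Finset ι, ∃ X : ZMod 2 → Set V, (∀ s, ∀ x ∈ X s, x ∈ S.part s) ∧
    (∀ s, ∀ x ∈ X s, ∀ i ∈ F, ∀ l, B.basis.repr (S.bracket x (B.basis i)) l ≠ 0 →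
      ∀ j ∈ F, j < l) ∧
    ∀ y : V, (∀ s, ∀ x ∈ X s, S.bracket x y = 0) → y = 0

namespace PBWAlgebra

theorem normal_word_mul_incl {w : List ι} {y : V}
    (h : ∀ l, B.basis.repr y l ≠ 0 → B.Admissible (w ++ [l])) (v : List ι) (l : ι) :
    P.normal (P.word w * P.incl y) (v ++ [l]) = if w = v then B.basis.repr y l else 0 := by
  have hy : P.word w * P.incl y =
      ∑ m ∈ (B.basis.repr y).support, B.basis.repr y m • P.word (w ++ [m]) := by
    conv_lhs => rw [← B.basis.linearCombination_repr y, Finsupp.linearCombination_apply,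
      Finsupp.sum, map_sum, Finset.mul_sum]
    refine Finset.sum_congr rfl fun m _ => ?_
    simp
  have hN : P.normal (P.word w * P.incl y) =
      ∑ m ∈ (B.basis.repr y).support, Finsupp.single (w ++ [m]) (B.basis.repr y m) := by
    rw [hy, map_sum]
    refine Finset.sum_congr rfl fun m hm => ?_
    rw [map_smul, P.normal_word (h m (Finsupp.mem_support_iff.mp hm)), Finsupp.smul_single,
      smul_eq_mul, mul_one]
  rw [hN, Finsupp.finsetSum_apply]
  simp only [Finsupp.single_apply, List.append_singleton_inj]
  split_ifs with hwv
  · simp only [hwv, true_and]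
    rw [Finset.sum_ite_eq' (B.basis.repr y).support l fun m => B.basis.repr y m]
    simp
  · simp [hwv]

variable {P} {z : U} {n : ℕ} {i : ZMod 2}

/-- The supercommutator of `x` with `z` vanishes. Replacing each `[x, w]` by its leading part
changes the sum only by words shorter than `n`. -/
theorem leading_commutator_mem_filtration (hz : z ∈ P.filtration (n + 1))
    (hzi : z ∈ P.parityPart i) {s : ZMod 2} {x : V} (hx : x ∈ S.part s)
    (hc : P.incl x * z = koszulSign k s i • (z * P.incl x)) :
    (∑ w ∈ (P.normal z).support, P.normal z w •
      ((B.deletions w).map fun d => (koszulSign k s (B.parity d.2.2) * d.1) •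
        (P.word d.2.2 * P.incl (S.bracket x (B.basis d.2.1)))).sum) ∈ P.filtration n := by
  have h0 : ∑ w ∈ (P.normal z).support, P.normal z w • (P.incl x * P.word w -
      koszulSign k s (B.parity w) • (P.word w * P.incl x)) = 0 := by
    rw [← sub_eq_zero] at hc
    rw [← hc]
    conv_rhs => rw [← P.sum_normal z, Finsupp.sum, Finset.mul_sum, Finset.sum_mul,
      Finset.smul_sum, ← Finset.sum_sub_distrib]
    refine Finset.sum_congr rfl fun w hw => ?_
    rw [P.parity_of_normal_ne_zero hzi (Finsupp.mem_support_iff.mp hw), smul_sub, mul_smul_comm,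
      smul_mul_assoc, smul_comm]
  rw [← neg_mem_iff, ← zero_sub, ← h0, ← Finset.sum_sub_distrib]
  refine Submodule.sum_mem _ fun w hw => ?_
  rw [← smul_sub]
  refine Submodule.smul_mem _ _ (P.filtration_mono ?_ (P.commutator_sub_deletions_mem_filtration hx w))
  exact Nat.lt_succ_iff.mp (P.length_lt_of_mem_filtration hz (Finsupp.mem_support_iff.mp hw))

/-- The left side is the `j`-coordinate of the vector `key`, the weighted sum of the letters whose
deletion leaves `v`. That vector vanishes because all separating elements kill it. -/
theorem sum_deletions_eq_zero (hB : B.HasSeparatingShifts) (hz : z ∈ P.filtration (n + 1))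
    (hzi : z ∈ P.parityPart i)
    (hc : ∀ s, ∀ x ∈ S.part s, P.incl x * z = koszulSign k s i • (z * P.incl x))
    {v : List ι} (hv : v.length + 1 = n) (j : ι) :
    ∑ w ∈ (P.normal z).support, P.normal z w *
      ((B.deletions w).map fun d => if d.2.2 = v then (if d.2.1 = j then d.1 else 0) else 0).sum
      = 0 := by
  obtain ⟨X, hX, hlt, hsep⟩ := hB ((P.normal z).support.biUnion List.toFinset)
  have hletter : ∀ w ∈ (P.normal z).support, ∀ l ∈ w,
      l ∈ (P.normal z).support.biUnion List.toFinset := fun w hw l hl =>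
    Finset.mem_biUnion.mpr ⟨w, hw, List.mem_toFinset.mpr hl⟩
  have key : ∑ w ∈ (P.normal z).support, P.normal z w •
      ((B.deletions w).map fun d => if d.2.2 = v then d.1 • B.basis d.2.1 else 0).sum = 0 := by
    refine hsep _ fun s x hx => ?_
    have hE := leading_commutator_mem_filtration hz hzi (hX s x hx) (hc s x (hX s x hx))
    refine B.basis.ext_elem fun l => ?_
    -- The word `v ++ [l]` has length `n`, too long to occur in `filtration n`. Its coordinate is,
    -- up to a sign, the `l`-coordinate of the bracket of `x` with the vector.
    have hE0 : P.normal (∑ w ∈ (P.normal z).support, P.normal z w •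
      ((B.deletions w).map fun d => (koszulSign k s (B.parity d.2.2) * d.1) •
        (P.word d.2.2 * P.incl (S.bracket x (B.basis d.2.1)))).sum) (v ++ [l]) = 0 := by
      by_contra hne
      have := P.length_lt_of_mem_filtration hE hne
      simp only [List.length_append, List.length_cons, List.length_nil] at this
      omega
    rw [map_zero, Finsupp.zero_apply, ← mul_right_inj' (koszulSign_ne_zero (k := k) s (B.parity v)),
      mul_zero, ← hE0]
    simp only [map_sum, map_smul, Finsupp.finsetSum_apply, Finsupp.smul_apply, Finset.mul_sum,
      smul_eq_mul]
    refine Finset.sum_congr rfl fun w hw => ?_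
    rw [mul_left_comm]
    congr 1
    have hl : ∀ (f : V →ₗ[k] k) (L : List V), f L.sum = (L.map f).sum := fun f L => map_list_sum f L
    have hl' : ∀ (f : U →ₗ[k] k) (L : List U), f L.sum = (L.map f).sum := fun f L => map_list_sum f L
    have e1 := hl (Finsupp.lapply l ∘ₗ B.basis.repr.toLinearMap ∘ₗ S.bracket x)
    have e2 := hl' (Finsupp.lapply (v ++ [l]) ∘ₗ P.normal)
    simp only [LinearMap.comp_apply, Finsupp.lapply_apply, LinearEquiv.coe_coe] at e1 e2
    rw [e1, e2, List.map_map, List.map_map, ← List.sum_map_mul_left]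
    congr 1
    refine List.map_congr_left fun d hd => ?_
    -- The appended letter exceeds all letters of `z`, so the new word is already sorted and needs
    -- no further rewriting.
    have hadm : ∀ m, B.basis.repr (S.bracket x (B.basis d.2.1)) m ≠ 0 →
        B.Admissible (d.2.2 ++ [m]) := by
      intro m hm
      have hp := B.deletions_perm hd
      refine List.pairwise_append.mpr ⟨(P.admissible_of_normal_ne_zero
        (Finsupp.mem_support_iff.mp hw)).sublist (B.deletions_sublist hd), by simp, ?_⟩
      intro a ha c hc
      rw [List.mem_singleton] at hc
      subst hc
      exact Or.inl (hlt s x hx _ (hletter w hw _ (hp.subset (by simp))) _ hm _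
        (hletter w hw _ (hp.subset (by simp [ha]))))
    simp only [Function.comp_apply, LinearMap.comp_apply, Finsupp.lapply_apply,
      LinearEquiv.coe_coe, map_smul, P.normal_word_mul_incl hadm, smul_eq_mul]
    split_ifs with h
    · simp [h, mul_assoc]
    · simp
  have hl : ∀ (f : V →ₗ[k] k) (L : List V), f L.sum = (L.map f).sum := fun f L => map_list_sum f L
  have e1 := hl (Finsupp.lapply j ∘ₗ B.basis.repr.toLinearMap)
  have := congrArg (fun y => B.basis.repr y j) key
  simp only [map_sum, map_smul, Finsupp.finsetSum_apply, Finsupp.smul_apply, map_zero,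
    Finsupp.zero_apply, smul_eq_mul] at this
  refine Eq.trans (Finset.sum_congr rfl fun w _ => ?_) this
  simp only [LinearMap.comp_apply, Finsupp.lapply_apply, LinearEquiv.coe_coe] at e1
  rw [e1, List.map_map]
  congr 2
  refine List.map_congr_left fun d _ => ?_
  simp only [Function.comp_apply, LinearMap.comp_apply, Finsupp.lapply_apply, LinearEquiv.coe_coe]
  split_ifs with h h'
  · simp [h']
  · simp [h']
  · simp

theorem exists_sum_ite_eq_of_count_eq_one {j : ι} (L : List (k × ι × List ι))
    (h : (L.map fun d => d.2.1).count j = 1) :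
    ∃ d ∈ L, (L.map fun d => if d.2.1 = j then d.1 else 0).sum = d.1 := by
  induction L with
  | nil => simp at h
  | cons a L ih =>
    rw [List.map_cons, List.count_cons] at h
    by_cases ha : a.2.1 = j
    · refine ⟨a, by simp, ?_⟩
      rw [List.map_cons, List.sum_cons, if_pos ha, List.sum_eq_zero, add_zero]
      simp only [ha, beq_self_eq_true, if_true, Nat.add_eq_right, List.count_eq_zero,
        List.mem_map, not_exists, not_and] at h
      intro x hx
      obtain ⟨d, hd, rfl⟩ := List.mem_map.mp hx
      exact if_neg (h d hd)
    · simp only [beq_iff_eq, ha, if_false, add_zero] at h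
      obtain ⟨d, hd, hs⟩ := ih h
      exact ⟨d, List.mem_cons_of_mem _ hd, by simp [ha, hs]⟩

/-- For even `j` all signs are `1` and the sum is the multiplicity of `j`. An odd `j` occurs just
once, so the sum is a single sign. -/
theorem sum_ite_deletions_ne_zero {w : List ι} (hw : B.Admissible w) {j : ι} (hj : j ∈ w)
    (h : B.par j = 0 → (w.count j : k) ≠ 0) :
    ((B.deletions w).map fun d => if d.2.1 = j then d.1 else 0).sum ≠ 0 := by
  rcases zmod_two_cases (B.par j) with hp | hp
  · have : ((B.deletions w).map fun d => if d.2.1 = j then d.1 else 0) =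
        ((B.deletions w).map fun d => d.2.1).map fun i => if i = j then (1 : k) else 0 := by
      rw [List.map_map]
      refine List.map_congr_left fun d hd => ?_
      obtain ⟨t, ht⟩ := B.deletions_sign hd
      rw [Function.comp_apply]
      split_ifs with hdj
      · rw [ht, hdj, hp, koszulSign_zero_left]
      · rfl
    rw [this, B.map_deletions]
    convert h hp
    generalize w = w
    induction w with
    | nil => simp
    | cons a w ih =>
      rw [List.map_cons, List.sum_cons, ih, List.count_cons]
      split_ifs with h1 h2 h2 <;> simp_all [add_comm]
  · have hcount : w.count j = 1 := by
      refine le_antisymm ?_ (List.one_le_count_iff.mpr hj)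
      by_contra hlt
      have hs := hw.sublist (List.replicate_sublist_iff.mpr (not_le.mp hlt))
      simp [hp] at hs
    obtain ⟨d, hd, hs⟩ := exists_sum_ite_eq_of_count_eq_one (j := j) (B.deletions w)
      (by rw [B.map_deletions, hcount])
    obtain ⟨t, ht⟩ := B.deletions_sign hd
    rw [hs, ht]
    exact koszulSign_ne_zero _ _

theorem _root_.LieSuperalgebra.HomogeneousBasis.Admissible.eq_of_perm {w w' : List ι}
    (hw : B.Admissible w) (hw' : B.Admissible w') (h : w.Perm w') : w = w' := by
  refine h.eq_of_pairwise (le := (· ≤ ·)) (fun _ _ _ _ => le_antisymm) ?_ ?_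
  · exact hw.imp fun h => h.elim le_of_lt fun h => h.1.le
  · exact hw'.imp fun h => h.elim le_of_lt fun h => h.1.le

/-- The leading words of a supercentral element have no odd letters, and the multiplicities of
their letters vanish in `k`. -/
theorem par_eq_zero_and_count_eq_zero (hB : B.HasSeparatingShifts)
    (hz : z ∈ P.filtration (n + 1)) (hzi : z ∈ P.parityPart i)
    (hc : ∀ s, ∀ x ∈ S.part s, P.incl x * z = koszulSign k s i • (z * P.incl x))
    {w : List ι} (hw : P.normal z w ≠ 0) (hn : w.length = n) {j : ι} (hj : j ∈ w) :
    B.par j = 0 ∧ (w.count j : k) = 0 := by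
  by_contra hcon
  rw [not_and] at hcon
  have hadm := P.admissible_of_normal_ne_zero hw
  have h1 := sum_deletions_eq_zero hB hz hzi hc (v := w.erase j)
    (by rw [List.length_erase_of_mem hj, ← hn]
        exact Nat.succ_pred_eq_of_pos (List.length_pos_of_mem hj)) j
  -- An admissible word is determined by its multiset of letters, so only `w` can leave `w.erase j`
  -- when `j` is deleted. The remaining term is the coefficient of `w` times the signed multiplicity
  -- of `j`.
  rw [Finset.sum_eq_single w] at h1
  · refine mul_ne_zero hw (sum_ite_deletions_ne_zero hadm hj hcon) ?_
    refine Eq.trans ?_ h1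
    congr 2
    refine List.map_congr_left fun d hd => ?_
    split_ifs with hdj hdv hdv <;> try rfl
    refine absurd ?_ hdv
    have hp := (B.deletions_perm hd).trans (List.perm_cons_erase hj)
    rw [hdj] at hp
    exact HomogeneousBasis.Admissible.eq_of_perm (hadm.sublist (B.deletions_sublist hd))
      (hadm.sublist List.erase_sublist) hp.cons_inv
  · intro w' hw' hne
    rw [List.sum_eq_zero, mul_zero]
    intro x hx
    obtain ⟨d, hd, rfl⟩ := List.mem_map.mp hx
    split_ifs with hdv hdj <;> try rfl
    refine absurd ?_ hne
    refine (P.admissible_of_normal_ne_zero (Finsupp.mem_support_iff.mp hw')).eq_of_perm hadm ?_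
    have hp := (B.deletions_perm hd).symm
    rw [hdv, hdj] at hp
    exact hp.trans (List.perm_cons_erase hj).symm
  · intro h
    exact absurd (Finsupp.mem_support_iff.mpr hw) h

end PBWAlgebra
end LieSuperalgebra

/-! ### Supercentral elements and words of `p`-th powers. -/

namespace LieSuperalgebra

open Module

variable {k : Type*} {V : Type*} [Field k] [AddCommGroup V] [Module k V]

variable {S : LieSuperalgebra k V} {ι : Type*} [LinearOrder ι] {B : S.HomogeneousBasis ι}
  {U : Type*} [Ring U] [Algebra k U] (P : PBWAlgebra B U)

namespace PBWAlgebra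

/-- The elements of parity `i` that supercommute with the Lie superalgebra. -/
def superCentral (i : ZMod 2) : Submodule k U where
  carrier := {z | z ∈ P.parityPart i ∧
    ∀ s, ∀ x ∈ S.part s, P.incl x * z = koszulSign k s i • (z * P.incl x)}
  zero_mem' := ⟨Submodule.zero_mem _, by simp⟩
  add_mem' := by
    rintro a c ⟨ha, ha'⟩ ⟨hc, hc'⟩
    refine ⟨Submodule.add_mem _ ha hc, fun s x hx => ?_⟩
    rw [mul_add, add_mul, smul_add, ha' s x hx, hc' s x hx]
  smul_mem' := by
    rintro r a ⟨ha, ha'⟩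
    refine ⟨Submodule.smul_mem _ r ha, fun s x hx => ?_⟩
    rw [mul_smul_comm, smul_mul_assoc, ha' s x hx, smul_comm]

theorem mul_mem_parityPart {i j : ZMod 2} {a c : U} (ha : a ∈ P.parityPart i)
    (hc : c ∈ P.parityPart j) : a * c ∈ P.parityPart (i + j) := by
  have := Submodule.mul_mem_mul ha hc
  rw [parityPart, parityPart, Submodule.span_mul_span] at this
  refine Submodule.span_le.mpr ?_ this
  rintro _ ⟨_, ⟨w, rfl, rfl⟩, _, ⟨w', rfl, rfl⟩, rfl⟩
  exact Submodule.subset_span ⟨w ++ w', by simp, by simp⟩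

theorem one_mem_parityPart : (1 : U) ∈ P.parityPart 0 :=
  Submodule.subset_span ⟨[], by simp, by simp⟩

theorem incl_mem_parityPart {i : ZMod 2} {x : V} (hx : x ∈ S.part i) :
    P.incl x ∈ P.parityPart i := by
  rw [B.part_eq_span] at hx
  induction hx using Submodule.span_induction with
  | zero => simp
  | add x y _ _ h h' => rw [map_add]; exact Submodule.add_mem _ h h'
  | smul c x _ h => rw [map_smul]; exact Submodule.smul_mem _ _ h
  | mem x hx =>
    obtain ⟨l, rfl, rfl⟩ := hx
    exact Submodule.subset_span ⟨[l], by simp, by simp⟩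

/-- The even part, as a subalgebra. -/
def evenSubalgebra : Subalgebra k U where
  carrier := P.parityPart 0
  mul_mem' ha hc := by simpa using P.mul_mem_parityPart ha hc
  add_mem' ha hc := Submodule.add_mem _ ha hc
  algebraMap_mem' r := by
    rw [Algebra.algebraMap_eq_smul_one]
    exact Submodule.smul_mem _ _ P.one_mem_parityPart

/-- Even letters commute up to a bracket, which is one letter instead of two. -/
theorem word_sub_word_mem_filtration_of_perm {w w' : List ι} (h : w.Perm w')
    (hw : ∀ l ∈ w, B.par l = 0) : P.word w - P.word w' ∈ P.filtration w.length := by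
  induction h with
  | nil => simp
  | @cons x w w' h ih =>
    rw [word_cons, word_cons, ← mul_sub, List.length_cons]
    exact P.mul_mem_filtration (by omega) (P.incl_mem_filtration _)
      (ih fun l hl => hw l (List.mem_cons_of_mem _ hl))
  | swap x y w =>
    have hy : B.basis y ∈ S.part 0 := hw y (by simp) ▸ B.mem y
    have hx : B.basis x ∈ S.part 0 := hw x (by simp) ▸ B.mem x
    have hm := P.incl_mul_incl hy hx
    rw [koszulSign_zero_left, one_smul] at hm
    have : P.word (y :: x :: w) - P.word (x :: y :: w) =
        P.incl (S.bracket (B.basis y) (B.basis x)) * P.word w := by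
      simp only [word_cons, ← mul_assoc, hm]
      rw [add_mul]
      abel
    rw [this]
    exact P.mul_mem_filtration (n := w.length + 1) (by simp; omega) (P.incl_mem_filtration _)
      (P.word_mem_filtration (Nat.lt_succ_self _))
  | @trans w₁ w₂ w₃ h _ ih ih' =>
    have h2 := ih' fun l hl => hw l (h.mem_iff.mpr hl)
    rw [← h.length_eq] at h2
    simpa using Submodule.add_mem _ (ih hw) h2

section PowerWord

variable {κ : Type*} (emb : κ → ι) (p : ℕ)

/-- The sorted word in which each letter of `m` is repeated `p` times. -/
def powerWord (m : Multiset κ) : List ι := ((p • m).map emb).sort (· ≤ ·)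

theorem length_powerWord (m : Multiset κ) : (powerWord emb p m).length = p * m.card := by
  simp [powerWord]

theorem powerWord_injective {emb : κ → ι} (hemb : Function.Injective emb) {p : ℕ} (hp : p ≠ 0) :
    Function.Injective (powerWord emb p) := by
  classical
  intro m m' h
  have h1 := congrArg (fun l : List ι => (l : Multiset ι)) h
  simp only [powerWord, Multiset.sort_eq] at h1
  have h2 := Multiset.map_injective hemb h1
  ext x
  have := congrArg (Multiset.count x) h2
  simpa [Multiset.count_nsmul, hp] using this

variable {emb} (hemb0 : ∀ x, B.par (emb x) = 0)

include hemb0 in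
theorem par_of_mem_powerWord {m : Multiset κ} {l : ι} (hl : l ∈ powerWord emb p m) :
    B.par l = 0 := by
  rw [powerWord, Multiset.mem_sort, Multiset.mem_map] at hl
  obtain ⟨x, -, rfl⟩ := hl
  exact hemb0 x

theorem admissible_of_sorted {w : List ι} (hw : w.Pairwise (· ≤ ·)) (hw0 : ∀ l ∈ w, B.par l = 0) :
    B.Admissible w := by
  refine hw.imp_of_mem fun {a b} ha _ hab => ?_
  exact hab.lt_or_eq.imp id fun h => ⟨h, hw0 a ha⟩

include hemb0 in
theorem admissible_powerWord (m : Multiset κ) : B.Admissible (powerWord emb p m) :=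
  admissible_of_sorted (Multiset.pairwise_sort _ _) fun _ => par_of_mem_powerWord p hemb0

-- Remove `p` copies of one letter at a time; divisibility of the multiplicities is preserved.
omit [LinearOrder ι] in
theorem exists_multiset_map_nsmul {p : ℕ} (hp : p ≠ 0) [DecidableEq ι] (M : Multiset ι)
    (h : ∀ l ∈ M, l ∈ Set.range emb ∧ p ∣ M.count l) : ∃ m : Multiset κ, (p • m).map emb = M := by
  induction M using Multiset.strongInductionOn with
  | ih M ih =>
    rcases M.empty_or_exists_mem with rfl | ⟨l, hl⟩
    · exact ⟨0, by simp⟩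
    · obtain ⟨⟨x, rfl⟩, hd⟩ := h l hl
      have hle : Multiset.replicate p (emb x) ≤ M := by
        rw [← Multiset.le_count_iff_replicate_le]
        exact Nat.le_of_dvd (Multiset.count_pos.mpr hl) hd
      obtain ⟨M', rfl⟩ := Multiset.le_iff_exists_add.mp hle
      obtain ⟨m, rfl⟩ := ih M' (by
        refine lt_of_le_of_ne (Multiset.le_add_left _ _) fun he => hp ?_
        have := congrArg Multiset.card he
        simpa using this) (fun l hl => by
          obtain ⟨h1, h2⟩ := h l (Multiset.mem_add.mpr (Or.inr hl))
          refine ⟨h1, ?_⟩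
          rw [Multiset.count_add, Multiset.count_replicate] at h2
          refine (Nat.dvd_add_right ?_).mp h2
          split_ifs <;> simp)
      exact ⟨x ::ₘ m, by
        rw [← Multiset.singleton_add, nsmul_add, Multiset.nsmul_singleton, Multiset.map_add,
          Multiset.map_replicate]⟩

include hemb0 in
theorem prod_sub_powerWord_mem_filtration {p : ℕ} (hp : 2 ≤ p) {z : κ → U} {q : κ → V}
    (hz : ∀ x, z x = P.incl (B.basis (emb x)) ^ p - P.incl (q x)) (l : List κ) :
    (l.map z).prod - P.word (powerWord emb p l) ∈ P.filtration (p * l.length) := by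
  have hrep : ∀ x, P.incl (B.basis (emb x)) ^ p = P.word (List.replicate p (emb x)) := fun x => by
    simp [word]
  have hlen : (l.flatMap fun x => List.replicate p (emb x)).length = p * l.length := by
    simp [List.length_flatMap, mul_comm]
  have h1 : (l.map z).prod - P.word (l.flatMap fun x => List.replicate p (emb x)) ∈
      P.filtration (p * l.length) := by
    clear hlen
    induction l with
    | nil => simp
    | cons x l ih =>
      have hZ : (l.map z).prod ∈ P.filtration (p * l.length + 1) := by
        rw [← sub_add_cancel (l.map z).prod (P.word (l.flatMap fun x => List.replicate p (emb x)))]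
        refine Submodule.add_mem _ (P.filtration_mono (Nat.le_succ _) ih)
          (P.word_mem_filtration ?_)
        simp [List.length_flatMap, mul_comm]
      have : ((x :: l).map z).prod -
          P.word ((x :: l).flatMap fun x => List.replicate p (emb x)) =
          P.word (List.replicate p (emb x)) * ((l.map z).prod -
            P.word (l.flatMap fun x => List.replicate p (emb x))) -
          P.incl (q x) * (l.map z).prod := by
        rw [List.map_cons, List.prod_cons, hz, hrep, List.flatMap_cons, word_append]
        noncomm_ring
      rw [this, List.length_cons, mul_add, mul_one]
      -- The linear term `q x` is shorter than the `p`-th power because `p ≥ 2`, so it does not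
      -- affect the leading word.
      refine Submodule.sub_mem _ (P.mul_mem_filtration (m := p + 1) (by omega)
        (P.word_mem_filtration (by simp)) ih)
        (P.mul_mem_filtration (by omega) (P.incl_mem_filtration _) hZ)
  have hperm : (l.flatMap fun x => List.replicate p (emb x)).Perm (powerWord emb p l) := by
    rw [← Multiset.coe_eq_coe, powerWord, Multiset.sort_eq]
    clear hlen h1
    induction l with
    | nil => simp
    | cons x l ih =>
      rw [List.flatMap_cons, ← Multiset.coe_add, ih, ← Multiset.cons_coe, ← Multiset.singleton_add,
        nsmul_add, Multiset.nsmul_singleton, Multiset.map_add, Multiset.map_replicate,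
        Multiset.coe_replicate]
  have h2 := P.word_sub_word_mem_filtration_of_perm hperm fun l hl => by
    rw [hperm.mem_iff] at hl
    exact par_of_mem_powerWord p hemb0 hl
  rw [hlen] at h2
  simpa using Submodule.add_mem _ h1 h2

end PowerWord

end PBWAlgebra
end LieSuperalgebra

/-! ### Free generation by central elements with `p`-th powers as leading terms. -/

namespace LieSuperalgebra

open Module

variable {k : Type*} {V : Type*} [Field k] [AddCommGroup V] [Module k V]

variable {S : LieSuperalgebra k V} {ι : Type*} [LinearOrder ι] {B : S.HomogeneousBasis ι}
  {U : Type*} [Ring U] [Algebra k U] {P : PBWAlgebra B U}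

/-- The homomorphism from a polynomial algebra given by a family of central elements. -/
noncomputable def centralHom {κ : Type*} {z : κ → U} (hz : ∀ x, z x ∈ Subalgebra.center k U) :
    MvPolynomial κ k →ₐ[k] U :=
  (Subalgebra.center k U).val.comp
    (MvPolynomial.aeval fun x => (⟨z x, hz x⟩ : Subalgebra.center k U))

section CentralHom

variable {κ : Type*} {z : κ → U} (hz : ∀ x, z x ∈ Subalgebra.center k U)

@[simp] theorem centralHom_X (x : κ) : centralHom hz (MvPolynomial.X x) = z x := by
  simp [centralHom]

theorem centralHom_mem_center (f : MvPolynomial κ k) : centralHom hz f ∈ Subalgebra.center k U :=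
  Subtype.property _

theorem centralHom_monomial (m : κ →₀ ℕ) :
    centralHom hz (MvPolynomial.monomial m 1) = (m.toMultiset.toList.map z).prod := by
  have h : MvPolynomial.monomial m (1 : k) =
      (m.toMultiset.toList.map (MvPolynomial.X : κ → MvPolynomial κ k)).prod := by
    rw [← Multiset.prod_coe, ← Multiset.map_coe, Multiset.coe_toList, MvPolynomial.monomial_eq,
      map_one, one_mul, Finsupp.toMultiset_map, Finsupp.prod_toMultiset,
      Finsupp.prod_mapDomain_index (by simp) (by simp [pow_add])]
  rw [h, map_list_prod, List.map_map]
  congr 2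
  ext x
  simp

theorem centralHom_eq_sum (f : MvPolynomial κ k) : centralHom hz f =
    ∑ m ∈ f.support, f.coeff m • (m.toMultiset.toList.map z).prod := by
  conv_lhs => rw [f.as_sum, map_sum]
  refine Finset.sum_congr rfl fun m _ => ?_
  rw [← centralHom_monomial hz, ← map_smul, MvPolynomial.smul_monomial, smul_eq_mul, mul_one]

end CentralHom

namespace PBWAlgebra

section

variable {κ : Type*} {emb : κ → ι} {p : ℕ} {z : κ → U} {q : κ → V}

theorem centralHom_mem_evenSubalgebra (hz : ∀ x, z x ∈ Subalgebra.center k U)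
    (hz0 : ∀ x, z x ∈ P.evenSubalgebra) (f : MvPolynomial κ k) :
    centralHom hz f ∈ P.evenSubalgebra := by
  rw [centralHom_eq_sum]
  refine Subalgebra.sum_mem _ fun m _ => Subalgebra.smul_mem _ (list_prod_mem ?_) _
  intro x hx
  obtain ⟨y, -, rfl⟩ := List.mem_map.mp hx
  exact hz0 y

theorem superCentral_zero_of_mem_center {u : U} (hu : u ∈ Subalgebra.center k U)
    (hu0 : u ∈ P.evenSubalgebra) : u ∈ P.superCentral 0 :=
  ⟨hu0, fun s x _ => by
    rw [koszulSign_zero_right, one_smul]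
    exact Subalgebra.mem_center_iff.mp hu _⟩

variable (hemb : Function.Injective emb) (hrange : Set.range emb = {l | B.par l = 0})
  (hp : 2 ≤ p) (hz : ∀ x, z x ∈ Subalgebra.center k U)
  (hzq : ∀ x, z x = P.incl (B.basis (emb x)) ^ p - P.incl (q x))

omit [LinearOrder ι] in
include hrange in
theorem par_emb (x : κ) : B.par (emb x) = 0 := by
  have : emb x ∈ {l | B.par l = 0} := hrange ▸ Set.mem_range_self x
  exact this

-- For a monomial `m₀` of maximal degree in `f`, the coordinate of the image at the power word of
-- `m₀` is the coefficient of `m₀`: lower-order terms of the other products are too short, and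
-- different monomials have different power words.
include hemb hrange hp hzq in
theorem centralHom_injective : Function.Injective (centralHom hz) := by
  classical
  rw [injective_iff_map_eq_zero]
  intro f hf
  by_contra hne
  obtain ⟨m₀, hm₀, hmax⟩ := Finset.exists_max_image f.support (fun m => m.toMultiset.card)
    (MvPolynomial.support_nonempty.mpr hne)
  have hcoef : ∀ m ∈ f.support, P.normal (m.toMultiset.toList.map z).prod
      (powerWord emb p m₀.toMultiset) = if m = m₀ then 1 else 0 := by
    intro m hm
    have h1 := P.prod_sub_powerWord_mem_filtration (par_emb hrange) hp hzq m.toMultiset.toList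
    rw [Multiset.coe_toList, Multiset.length_toList] at h1
    have h2 : P.normal ((m.toMultiset.toList.map z).prod - P.word (powerWord emb p m.toMultiset))
        (powerWord emb p m₀.toMultiset) = 0 := by
      by_contra h
      have := P.length_lt_of_mem_filtration h1 h
      rw [length_powerWord] at this
      exact absurd (hmax m hm) (not_le.mpr (lt_of_mul_lt_mul_left this (Nat.zero_le p)))
    rw [map_sub, Finsupp.sub_apply, sub_eq_zero,
      P.normal_word (admissible_powerWord p (par_emb hrange) _), Finsupp.single_apply] at h2
    rw [h2]
    have : powerWord emb p m.toMultiset = powerWord emb p m₀.toMultiset ↔ m = m₀ :=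
      (powerWord_injective hemb (by omega)).eq_iff.trans
        (Function.LeftInverse.injective Finsupp.toMultiset_toFinsupp).eq_iff
    simp only [this]
  have h0 := congrArg (fun u => P.normal u (powerWord emb p m₀.toMultiset)) hf
  simp only [centralHom_eq_sum, map_sum, map_smul, Finsupp.finsetSum_apply, Finsupp.smul_apply,
    map_zero, Finsupp.zero_apply] at h0
  rw [Finset.sum_congr rfl fun m hm => by rw [hcoef m hm]] at h0
  simp only [smul_eq_mul, mul_ite, mul_one, mul_zero, Finset.sum_ite_eq', hm₀, if_true] at h0
  exact MvPolynomial.mem_support_iff.mp hm₀ h0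

-- Induction on the filtration: the part of length `n` is matched by a combination `t` of monomials,
-- and `u - t` is supercentral with shorter words.
include hrange hp hz hzq in
theorem superCentral_le_range_centralHom [CharP k p] (hB : B.HasSeparatingShifts)
    (hz0 : ∀ x, z x ∈ P.evenSubalgebra) (i : ZMod 2) :
    P.superCentral i ≤ (centralHom hz).range.toSubmodule := by
  classical
  have main : ∀ n, ∀ u ∈ P.superCentral i, u ∈ P.filtration n → u ∈ (centralHom hz).range := by
    intro n
    induction n with
    | zero =>
      intro u _ hu
      rw [filtration_zero, Submodule.mem_bot] at hu
      rw [hu]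
      exact Subalgebra.zero_mem _
    | succ n ih =>
      intro u hu hun
      -- A leading word has only even letters, so its existence forces `i = 0`. For `i = 1` the sum
      -- `t` below is therefore empty, and the induction drives `u` down to zero.
      have hlead : ∀ w, P.normal u w ≠ 0 → w.length = n → ∃ f : MvPolynomial κ k,
          i = 0 ∧ P.word w - centralHom hz f ∈ P.filtration n := by
        intro w hw hn
        have hw' := fun j hj => par_eq_zero_and_count_eq_zero (j := j) hB hun hu.1 hu.2 hw hn hj
        obtain ⟨m, hm⟩ := exists_multiset_map_nsmul (emb := emb) (p := p) (by omega) (w : Multiset ι)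
          (fun l hl => by
            obtain ⟨h1, h2⟩ := hw' l hl
            exact ⟨hrange ▸ h1, by
              rw [Multiset.coe_count]
              exact (CharP.cast_eq_zero_iff k p _).mp h2⟩)
        have hwm : powerWord emb p m = w := by
          refine (admissible_powerWord p (par_emb hrange) m).eq_of_perm
            (P.admissible_of_normal_ne_zero hw) ?_
          rw [← Multiset.coe_eq_coe, powerWord, Multiset.sort_eq, hm]
        refine ⟨MvPolynomial.monomial (Multiset.toFinsupp m) 1, ?_, ?_⟩
        · rw [← P.parity_of_normal_ne_zero hu.1 hw, HomogeneousBasis.parity]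
          refine List.sum_eq_zero fun x hx => ?_
          obtain ⟨l, hl, rfl⟩ := List.mem_map.mp hx
          exact (hw' l hl).1
        · have h1 := P.prod_sub_powerWord_mem_filtration (par_emb hrange) hp hzq m.toList
          rw [Multiset.coe_toList, hwm, Multiset.length_toList, ← length_powerWord emb, hwm, hn] at h1
          rw [centralHom_monomial, Multiset.toFinsupp_toMultiset, ← neg_mem_iff, neg_sub]
          exact h1
      choose! f hfi hf using hlead
      set t := ∑ w ∈ (P.normal u).support with w.length = n, P.normal u w • centralHom hz (f w)
        with ht
      have htr : t ∈ (centralHom hz).range :=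
        Subalgebra.sum_mem _ fun w _ => Subalgebra.smul_mem _ (AlgHom.mem_range_self _ _) _
      have htc : t ∈ P.superCentral i := by
        refine Submodule.sum_mem _ fun w hw => Submodule.smul_mem _ _ ?_
        rw [Finset.mem_filter, Finsupp.mem_support_iff] at hw
        rw [hfi w hw.1 hw.2]
        exact superCentral_zero_of_mem_center (centralHom_mem_center hz _)
          (centralHom_mem_evenSubalgebra hz hz0 _)
      have hsub : u - t ∈ P.filtration n := by
        have hu' : u = (∑ w ∈ (P.normal u).support with w.length = n, P.normal u w • P.word w) +
            ∑ w ∈ (P.normal u).support with ¬ w.length = n, P.normal u w • P.word w := by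
          rw [Finset.sum_filter_add_sum_filter_not]
          exact (P.sum_normal u).symm
        have : u - t = (∑ w ∈ (P.normal u).support with w.length = n,
            P.normal u w • (P.word w - centralHom hz (f w))) +
            ∑ w ∈ (P.normal u).support with ¬ w.length = n, P.normal u w • P.word w := by
          simp only [smul_sub, Finset.sum_sub_distrib]
          rw [← ht]
          nth_rewrite 1 [hu']
          abel
        rw [this]
        refine Submodule.add_mem _ (Submodule.sum_mem _ fun w hw => Submodule.smul_mem _ _ ?_)
          (Submodule.sum_mem _ fun w hw => Submodule.smul_mem _ _ ?_)
        · rw [Finset.mem_filter, Finsupp.mem_support_iff] at hw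
          exact hf w hw.1 hw.2
        · rw [Finset.mem_filter, Finsupp.mem_support_iff] at hw
          refine P.word_mem_filtration ?_
          have := P.length_lt_of_mem_filtration hun hw.1
          omega
      have := ih (u - t) (Submodule.sub_mem _ hu htc) hsub
      rw [← sub_add_cancel u t]
      exact Subalgebra.add_mem _ this htr
  intro u hu
  obtain ⟨n, hn⟩ := P.exists_mem_filtration u
  exact main n u hu hn

include hemb hrange hp hzq in
/-- The center of an enveloping algebra in characteristic `p` is freely generated by central
elements `xᵖ - q`, where `x` runs through the even part of the basis and `q` is linear. -/
theorem freelyGeneratedBy [CharP k p] (hB : B.HasSeparatingShifts)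
    (hz : ∀ x, z x ∈ Subalgebra.center k U)
    (hz0 : ∀ x, z x ∈ P.evenSubalgebra) {Z : Submodule k U}
    (hZ : ∀ u ∈ P.evenSubalgebra, u ∈ Subalgebra.center k U → u ∈ Z)
    (hZ' : Z ≤ P.superCentral 0 ⊔ P.superCentral 1) : FreelyGeneratedBy Z z := by
  refine ⟨centralHom hz, centralHom_X hz, centralHom_injective hemb hrange hp hz hzq, ?_⟩
  ext u
  constructor
  · rintro ⟨f, rfl⟩
    exact hZ _ (centralHom_mem_evenSubalgebra hz hz0 f) (centralHom_mem_center hz f)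
  · intro hu
    have h := superCentral_le_range_centralHom hrange hp hz hzq hB hz0
    exact (sup_le (h 0) (h 1)) (hZ' hu)

end

end PBWAlgebra
end LieSuperalgebra

/-! ### Centrality of `x ^ p - x^[p]` and the center of the enveloping algebra. -/

namespace LieSuperalgebra

open Module

variable {k : Type*} {V : Type*} [Field k] [AddCommGroup V] [Module k V]

namespace PBWAlgebra

variable {S : LieSuperalgebra k V} {ι : Type*} [LinearOrder ι] {B : S.HomogeneousBasis ι}
  {U : Type*} [Ring U] [Algebra k U] (P : PBWAlgebra B U)

include P in
theorem nontrivial : Nontrivial U := by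
  refine ⟨⟨P.word [], 0, fun h => ?_⟩⟩
  have h1 := P.normal_word (w := []) List.Pairwise.nil
  rw [h, map_zero] at h1
  have := congrArg (fun f => f []) h1
  simp at this

theorem mem_center_of_commute {u : U} (h : ∀ x, P.incl x * u = u * P.incl x) :
    u ∈ Subalgebra.center k U := by
  have hw : ∀ w, P.word w * u = u * P.word w := by
    intro w
    induction w with
    | nil => simp
    | cons i w ih => rw [word_cons, mul_assoc, ih, ← mul_assoc, h, mul_assoc]
  rw [Subalgebra.mem_center_iff]
  intro a
  rw [← P.sum_normal a, Finsupp.sum, Finset.sum_mul, Finset.mul_sum]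
  refine Finset.sum_congr rfl fun w _ => ?_
  rw [smul_mul_assoc, mul_smul_comm, hw]

theorem incl_commutator {x : V} (hx : x ∈ S.part 0) (y : V) :
    P.incl x * P.incl y - P.incl y * P.incl x = P.incl (S.bracket x y) := by
  have hy : y ∈ S.part 0 ⊔ S.part 1 := by rw [S.isCompl.sup_eq_top]; trivial
  have key : ∀ s, ∀ y ∈ S.part s,
      P.incl x * P.incl y - P.incl y * P.incl x = P.incl (S.bracket x y) := by
    intro s y hy
    rw [P.incl_mul_incl hx hy, koszulSign_zero_left, one_smul, add_sub_cancel_left]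
  obtain ⟨a, ha, c, hc, rfl⟩ := Submodule.mem_sup.mp hy
  rw [map_add, map_add, map_add, ← key 0 a ha, ← key 1 c hc]
  noncomm_ring

/-- Left and right multiplication by `x` commute, so in characteristic `p` the `p`-th power of their
difference is the difference of the multiplications by `x ^ p`. On the Lie superalgebra this power
is `(ad x) ^ p = ad q`. -/
theorem pow_sub_mem_center {p : ℕ} [Fact p.Prime] [CharP k p] {x q : V} (hx : x ∈ S.part 0)
    (hq : q ∈ S.part 0)
    (hxq : (S.bracket q : Module.End k V) = (S.bracket x : Module.End k V) ^ p) :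
    P.incl x ^ p - P.incl q ∈ Subalgebra.center k U := by
  have := P.nontrivial
  have : CharP (Module.End k U) p :=
    charP_of_injective_algebraMap (algebraMap k (Module.End k U)).injective p
  refine P.mem_center_of_commute fun y => ?_
  have hD : ∀ n : ℕ, ((LinearMap.mulLeft k (P.incl x) - LinearMap.mulRight k (P.incl x) :
      Module.End k U) ^ n) (P.incl y) =
      P.incl (((S.bracket x : Module.End k V) ^ n) y) := by
    intro n
    induction n with
    | zero => simp
    | succ n ih =>
      rw [pow_succ', Module.End.mul_apply, ih, pow_succ', Module.End.mul_apply,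
        LinearMap.sub_apply, LinearMap.mulLeft_apply, LinearMap.mulRight_apply,
        P.incl_commutator hx]
  have h := hD p
  rw [sub_pow_char_of_commute _ (LinearMap.commute_mulLeft_right _ _), LinearMap.pow_mulLeft,
    LinearMap.pow_mulRight, ← hxq, ← P.incl_commutator hq, LinearMap.sub_apply,
    LinearMap.mulLeft_apply, LinearMap.mulRight_apply] at h
  rw [sub_mul, mul_sub]
  linear_combination (norm := abel) -h

theorem pow_sub_mem_evenSubalgebra (p : ℕ) {x q : V} (hx : x ∈ S.part 0) (hq : q ∈ S.part 0) :
    P.incl x ^ p - P.incl q ∈ P.evenSubalgebra :=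
  Subalgebra.sub_mem _ (Subalgebra.pow_mem _ (P.incl_mem_parityPart hx) p)
    (P.incl_mem_parityPart hq)

end PBWAlgebra

section Env

variable {S : LieSuperalgebra k V} {ι : Type*} [LinearOrder ι] [NeZero (2 : k)]
  (B : S.HomogeneousBasis ι)

theorem HomogeneousBasis.envPart_le_parityPart (i : ZMod 2) :
    S.envPart i ≤ B.envPBW.parityPart i := by
  refine Submodule.span_le.mpr ?_
  rintro _ ⟨l, rfl, rfl⟩
  induction l with
  | nil => exact B.envPBW.one_mem_parityPart
  | cons x l ih =>
    simp only [List.map_cons, List.sum_cons, List.prod_cons]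
    exact B.envPBW.mul_mem_parityPart (B.envPBW.incl_mem_parityPart x.2.2) ih

theorem HomogeneousBasis.parityPart_le_envPart (i : ZMod 2) :
    B.envPBW.parityPart i ≤ S.envPart i := by
  refine Submodule.span_le.mpr ?_
  rintro _ ⟨w, rfl, rfl⟩
  refine Submodule.subset_span ⟨w.map fun i => ⟨B.par i, B.basis i, B.mem i⟩, ?_, ?_⟩
  · rw [List.map_map]; rfl
  · rw [List.map_map]; rfl

omit [NeZero (2 : k)] in
theorem envι_mem_envPart {s : ZMod 2} {x : V} (hx : x ∈ S.part s) : S.envι x ∈ S.envPart s :=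
  Submodule.subset_span ⟨[⟨s, x, hx⟩], by simp, by simp⟩

theorem HomogeneousBasis.centerPart_le_superCentral (i : ZMod 2) :
    S.centerPart i ≤ B.envPBW.superCentral i := by
  rintro z ⟨hz, hz'⟩
  refine ⟨B.envPart_le_parityPart i hz, fun s x hx => ?_⟩
  have h := sub_eq_zero.mp (hz' s _ (envι_mem_envPart hx))
  have h' : z * B.envPBW.incl x = koszulSign k i s • (B.envPBW.incl x * z) := h
  rw [h', smul_smul, koszulSign_comm s i, koszulSign_mul_self, one_smul]

theorem HomogeneousBasis.mem_envCenter {u : S.Env} (hu : u ∈ B.envPBW.evenSubalgebra)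
    (hu' : u ∈ Subalgebra.center k S.Env) : u ∈ S.envCenter := by
  refine Submodule.mem_sup_left ⟨B.parityPart_le_envPart 0 hu, fun j v _ => ?_⟩
  have h : v * u = u * v := Subalgebra.mem_center_iff.mp hu' v
  have h1 : ∀ c : k, c = 1 → u * v - c • (v * u) = 0 := by
    rintro _ rfl
    rw [h, one_smul, sub_self]
  exact h1 _ (by simp)

/-- Free generation of the center of the enveloping algebra of a Lie superalgebra with
separating shifts and a `p`-map on a basis of its even part. -/
theorem HomogeneousBasis.freelyGeneratedBy_envCenter (hB : B.HasSeparatingShifts) {p : ℕ}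
    [Fact p.Prime] [CharP k p] {κ : Type*} {emb : κ → ι} (hemb : Function.Injective emb)
    (hrange : Set.range emb = {l | B.par l = 0}) {q : κ → V} (hq : ∀ x, q x ∈ S.part 0)
    (hadq : ∀ x, (S.bracket (q x) : Module.End k V) =
      (S.bracket (B.basis (emb x)) : Module.End k V) ^ p) :
    FreelyGeneratedBy S.envCenter
      (fun x => S.envι (B.basis (emb x)) ^ p - S.envι (q x)) := by
  have hmem : ∀ x, B.basis (emb x) ∈ S.part 0 := fun x =>
    PBWAlgebra.par_emb hrange x ▸ B.mem (emb x)
  exact PBWAlgebra.freelyGeneratedBy (P := B.envPBW) hemb hrange (Fact.out : p.Prime).two_le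
    (fun _ => rfl) hB (fun x => B.envPBW.pow_sub_mem_center (hmem x) (hq x) (hadq x))
    (fun x => B.envPBW.pow_sub_mem_evenSubalgebra p (hmem x) (hq x))
    (fun u hu hu' => B.mem_envCenter hu hu')
    (sup_le_sup (B.centerPart_le_superCentral 0) (B.centerPart_le_superCentral 1))

end Env

end LieSuperalgebra

/-! ### Semisimplicity and separating shifts in `L ⊗ A`. -/

namespace LieSuperalgebra

open Module

variable {k : Type*} {L : Type*} [Field k] [AddCommGroup L] [Module k L]

theorem bracket_eq_zero_of_homogeneous {S : LieSuperalgebra k L} {x : L}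
    (h : ∀ s, ∀ y ∈ S.part s, S.bracket y x = 0) (y : L) : S.bracket y x = 0 := by
  have hy : y ∈ S.part 0 ⊔ S.part 1 := by rw [S.isCompl.sup_eq_top]; trivial
  obtain ⟨a, ha, c, hc, rfl⟩ := Submodule.mem_sup.mp hy
  rw [map_add, LinearMap.add_apply, h 0 a ha, h 1 c hc, add_zero]

/-- The center is an abelian ideal, hence solvable. It is graded because, for homogeneous `y`, the
brackets with the two components of a central element lie in different parts. -/
theorem IsSemisimple.eq_zero_of_bracket_eq_zero {S : LieSuperalgebra k L} (hS : S.IsSemisimple)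
    {x : L} (hx : ∀ y, S.bracket y x = 0) : x = 0 := by
  let N : Submodule k L :=
    { carrier := {x | ∀ y, S.bracket y x = 0}
      zero_mem' := by simp
      add_mem' := fun {a c} ha hc y => by rw [map_add, ha y, hc y, add_zero]
      smul_mem' := fun r a ha y => by rw [map_smul, ha y, smul_zero] }
  have hN : S.IsIdeal N := by
    refine ⟨le_antisymm ?_ (sup_le inf_le_left inf_le_left), fun y z hz => ?_⟩
    · intro a ha
      have ha' : a ∈ S.part 0 ⊔ S.part 1 := by rw [S.isCompl.sup_eq_top]; trivial
      obtain ⟨c, hc, d, hd, rfl⟩ := Submodule.mem_sup.mp ha'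
      have key : ∀ s, ∀ y ∈ S.part s, S.bracket y c = 0 := by
        intro s y hy
        have h0 := ha y
        rw [map_add] at h0
        have h1 := S.bracket_mem s 0 y c hy hc
        have h2 := S.bracket_mem s 1 y d hy hd
        rw [eq_neg_of_add_eq_zero_right h0] at h2
        exact HomogeneousBasis.eq_zero_of_mem_of_ne (by simp) h1 ((Submodule.neg_mem_iff _).mp h2)
      have hcN : c ∈ N := bracket_eq_zero_of_homogeneous key
      have hdN : d ∈ N := by
        have := N.sub_mem ha hcN
        rwa [add_sub_cancel_left] at this
      exact Submodule.add_mem_sup ⟨hcN, hc⟩ ⟨hdN, hd⟩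
    · rw [show S.bracket y z = 0 from hz y]
      exact N.zero_mem
  have hbot : N = ⊥ := by
    refine hS N hN ⟨1, ?_⟩
    rw [derived, Submodule.span_eq_bot]
    rintro _ ⟨a, _, c, hc, rfl⟩
    exact hc a
  have : x ∈ N := hx
  rwa [hbot, Submodule.mem_bot] at this

/-- The homogeneous basis made of a basis of the even part and one of the odd part. -/
noncomputable def homogeneousBasisOfParts (S : LieSuperalgebra k L) {I₀ I₁ : Type*}
    (e : Basis I₀ k (S.part 0)) (f : Basis I₁ k (S.part 1)) :
    S.HomogeneousBasis (I₀ ⊕ I₁) where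
  basis := (e.prod f).map (Submodule.prodEquivOfIsCompl _ _ S.isCompl)
  par := Sum.elim (fun _ => 0) (fun _ => 1)
  mem := by
    rintro (i | i)
    · simp
    · simp

theorem homogeneousBasisOfParts_inl (S : LieSuperalgebra k L) {I₀ I₁ : Type*}
    (e : Basis I₀ k (S.part 0)) (f : Basis I₁ k (S.part 1)) (i : I₀) :
    (S.homogeneousBasisOfParts e f).basis (Sum.inl i) = e i := by
  simp [homogeneousBasisOfParts]

section Tensor

variable {S : LieSuperalgebra k L} {J : Type*} (C : S.HomogeneousBasis J)
  {A : Type*} [CommRing A] [Algebra k A] {Γ : Type*} (a : Basis Γ k A)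

/-- The homogeneous basis of `L ⊗ A` given by bases of `L` and of `A`, indexed so that the index
in `A` is compared first. -/
noncomputable def HomogeneousBasis.tensor : (S.tensor A).HomogeneousBasis (Γ ×ₗ J) where
  basis := (C.basis.tensorProduct a).reindex ((Equiv.prodComm J Γ).trans toLex)
  par x := C.par (ofLex x).2
  mem x := by
    simp only [Basis.reindex_apply, Basis.tensorProduct_apply']
    exact Submodule.subset_span ⟨_, C.mem _, _, rfl⟩

theorem HomogeneousBasis.tensor_basis (x : Γ ×ₗ J) :
    (C.tensor a).basis x = C.basis (ofLex x).2 ⊗ₜ[k] a (ofLex x).1 := by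
  simp only [HomogeneousBasis.tensor, Basis.reindex_apply, Basis.tensorProduct_apply']
  rfl

theorem HomogeneousBasis.tensor_repr_tmul (y : L) (c : A) (x : Γ ×ₗ J) :
    (C.tensor a).basis.repr (y ⊗ₜ[k] c) x = C.basis.repr y (ofLex x).2 * a.repr c (ofLex x).1 := by
  rw [HomogeneousBasis.tensor, Basis.repr_reindex_apply, mul_comm, ← smul_eq_mul]
  exact Basis.tensorProduct_repr_tmul_apply _ _ _ _ _ _

variable {a} [AddCommMonoid Γ] (ha : ∀ r s, a r * a s = a (r + s))

-- Write `X = ∑ c r ⊗ a r`. The bracket is `∑ [y, c r] ⊗ a (m + r)`, and by cancellation these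
-- exponents stay distinct, so every `c r` is central in `L`.
include ha in
theorem eq_zero_of_tensorBracket_eq_zero [IsLeftCancelAdd Γ]
    (hS : ∀ x : L, (∀ y, S.bracket y x = 0) → x = 0) (m : Γ) {X : L ⊗[k] A}
    (hX : ∀ s, ∀ y ∈ S.part s, S.tensorBracket A (y ⊗ₜ[k] a m) X = 0) : X = 0 := by
  classical
  obtain ⟨c, rfl⟩ := (TensorProduct.equivFinsuppOfBasisRight (M := L) a).symm.surjective X
  have hc : c = 0 := by
    ext r
    refine hS _ (bracket_eq_zero_of_homogeneous fun s y hy => ?_)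
    have h := hX s y hy
    rw [TensorProduct.equivFinsuppOfBasisRight_symm_apply, Finsupp.sum, map_sum] at h
    simp only [tensorBracket_tmul, ha] at h
    have h' := congrArg (fun z => TensorProduct.equivFinsuppOfBasisRight (M := L) a z (m + r)) h
    simp only [map_sum, Finsupp.finsetSum_apply,
      TensorProduct.equivFinsuppOfBasisRight_apply_tmul_apply, Basis.repr_self,
      Finsupp.single_apply, add_right_inj, ite_smul, one_smul, zero_smul, map_zero,
      Finsupp.zero_apply] at h'
    rw [Finset.sum_ite_eq'] at h'
    split_ifs at h' with hr
    · exact h'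
    · rw [Finsupp.notMem_support_iff.mp hr, map_zero]
  rw [hc, map_zero]

-- The separating elements are all `y ⊗ a m` with one large `m`. As exponents are compared first,
-- the shifted letters exceed those of `F` whatever `[y, e_i]` is.
include ha in
theorem HomogeneousBasis.tensor_hasSeparatingShifts [LinearOrder Γ] [IsLeftCancelAdd Γ]
    [LinearOrder J] (hΓ : ∀ F : Finset Γ, ∃ m, ∀ r ∈ F, ∀ s ∈ F, s < m + r)
    (hS : ∀ x : L, (∀ y, S.bracket y x = 0) → x = 0) :
    (C.tensor a).HasSeparatingShifts := by
  classical
  intro F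
  obtain ⟨m, hm⟩ := hΓ (F.image fun x => (ofLex x).1)
  refine ⟨fun s => {x | ∃ y ∈ S.part s, x = y ⊗ₜ[k] a m}, ?_, ?_, ?_⟩
  · rintro s _ ⟨y, hy, rfl⟩
    exact Submodule.subset_span ⟨y, hy, _, rfl⟩
  · rintro s _ ⟨y, hy, rfl⟩ i hi l hl j hj
    have hbr : (S.tensor A).bracket (y ⊗ₜ[k] a m) ((C.tensor a).basis i) =
        S.bracket y (C.basis (ofLex i).2) ⊗ₜ[k] a (m + (ofLex i).1) := by
      rw [tensor_basis, ← ha]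
      exact S.tensorBracket_tmul A _ _ _ _
    rw [hbr, tensor_repr_tmul, Basis.repr_self] at hl
    have hl' := right_ne_zero_of_mul hl
    rw [Finsupp.single_apply_ne_zero] at hl'
    refine Prod.Lex.lt_iff.mpr (Or.inl ?_)
    rw [hl'.1]
    exact hm _ (Finset.mem_image_of_mem _ hi) _ (Finset.mem_image_of_mem _ hj)
  · intro X hX
    exact eq_zero_of_tensorBracket_eq_zero ha hS m fun s y hy => hX s _ ⟨y, hy, rfl⟩

omit [AddCommMonoid Γ] in
theorem tensorBracket_pow_tmul (x y : L) (b c : A) (n : ℕ) :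
    ((S.tensorBracket A (x ⊗ₜ[k] b) : Module.End k (L ⊗[k] A)) ^ n) (y ⊗ₜ[k] c) =
      ((S.bracket x : Module.End k L) ^ n) y ⊗ₜ[k] (b ^ n * c) := by
  induction n with
  | zero => simp
  | succ n ih =>
    rw [pow_succ', Module.End.mul_apply, ih, tensorBracket_tmul, pow_succ' (S.bracket x),
      Module.End.mul_apply, pow_succ' b, mul_assoc]

include ha in
/-- The center of the enveloping algebra of `L ⊗ A`, for an algebra `A` with a multiplicatively
closed basis that is indexed by a suitable ordered monoid. -/
theorem freelyGeneratedBy_tensor_envCenter {p : ℕ} [Fact p.Prime] [CharP k p] (hp : p ≠ 2)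
    (R : S.Restriction p) (hS : S.IsSemisimple) {I₀ : Type*} (e : Basis I₀ k (S.part 0))
    [LinearOrder Γ] [IsLeftCancelAdd Γ]
    (hΓ : ∀ F : Finset Γ, ∃ m, ∀ r ∈ F, ∀ s ∈ F, s < m + r) :
    FreelyGeneratedBy (S.tensor A).envCenter (fun ir : I₀ × Γ =>
      (S.tensor A).envι ((e ir.1 : L) ⊗ₜ[k] a ir.2) ^ p -
        (S.tensor A).envι ((R.pmap (e ir.1) : L) ⊗ₜ[k] (a ir.2 ^ p))) := by
  classical
  have : NeZero (2 : k) := ⟨fun h => by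
    have h2 : ((2 : ℕ) : k) = 0 := by exact_mod_cast h
    rw [CharP.cast_eq_zero_iff k p] at h2
    exact hp ((Nat.prime_dvd_prime_iff_eq Fact.out Nat.prime_two).mp h2)⟩
  let f := Basis.ofVectorSpace k (S.part 1)
  let C := S.homogeneousBasisOfParts e f
  -- Any linear order on the basis of `L` will do, since the exponent decides first.
  let _ : LinearOrder (I₀ ⊕ Basis.ofVectorSpaceIndex k (S.part 1)) :=
    linearOrderOfSTO WellOrderingRel
  have hB := C.tensor_hasSeparatingShifts ha hΓ fun x hx => hS.eq_zero_of_bracket_eq_zero hx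
  have hb : ∀ ir : I₀ × Γ, (C.tensor a).basis (toLex (ir.2, Sum.inl ir.1)) =
      (e ir.1 : L) ⊗ₜ[k] a ir.2 := fun ir => by
    rw [HomogeneousBasis.tensor_basis, ofLex_toLex]
    exact congrArg (· ⊗ₜ[k] a ir.2) (S.homogeneousBasisOfParts_inl e f ir.1)
  have key := (C.tensor a).freelyGeneratedBy_envCenter hB (p := p)
    (emb := fun ir : I₀ × Γ => toLex (ir.2, Sum.inl ir.1))
    (fun x y h => by
      have h' := toLex_inj.mp h
      simp only [Prod.mk.injEq, Sum.inl.injEq] at h'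
      exact Prod.ext h'.2 h'.1)
    (by
      ext x
      constructor
      · rintro ⟨ir, rfl⟩
        rfl
      · intro hx
        obtain ⟨⟨r, i | i⟩, rfl⟩ := toLex.surjective x
        · exact ⟨(i, r), rfl⟩
        · exact absurd hx (by change ¬ ((1 : ZMod 2) = 0); decide))
    (q := fun ir => (R.pmap (e ir.1) : L) ⊗ₜ[k] (a ir.2 ^ p))
    (fun ir => Submodule.subset_span ⟨_, (R.pmap (e ir.1)).2, _, rfl⟩)
    (fun ir => by
      rw [hb]
      refine TensorProduct.ext' fun y c => ?_
      refine (S.tensorBracket_tmul A _ _ _ _).trans ?_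
      refine Eq.trans ?_ (tensorBracket_pow_tmul _ y _ c p).symm
      rw [R.ad_pmap])
  simpa only [hb] using key

end Tensor

end LieSuperalgebra

/-! ### The current and loop superalgebras. -/

theorem proposition4p2p3 {k : Type*} [Field k] [IsAlgClosed k] (p : ℕ) [Fact p.Prime] [CharP k p]
    (hp : p ≠ 2) {L : Type*} [AddCommGroup L] [Module k L] (S : LieSuperalgebra k L)
    (R : S.Restriction p) (hS : S.IsSemisimple)
    {I₀ : Type*} (e : Module.Basis I₀ k (S.part 0)) :
    FreelyGeneratedBy S.current.envCenter
      (fun ir : I₀ × ℕ =>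
        S.current.envι ((e ir.1 : L) ⊗ₜ[k] (Polynomial.X ^ ir.2 : k[X])) ^ p
          - S.current.envι ((R.pmap (e ir.1) : L) ⊗ₜ[k] (Polynomial.X ^ (ir.2 * p) : k[X]))) ∧
    FreelyGeneratedBy S.loop.envCenter
      (fun ir : I₀ × ℤ =>
        S.loop.envι ((e ir.1 : L) ⊗ₜ[k] (LaurentPolynomial.T ir.2 : k[T;T⁻¹])) ^ p
          - S.loop.envι
            ((R.pmap (e ir.1) : L) ⊗ₜ[k] (LaurentPolynomial.T (ir.2 * p) : k[T;T⁻¹]))) := by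
  constructor
  · have h := LieSuperalgebra.freelyGeneratedBy_tensor_envCenter (a := Polynomial.basisMonomials k)
      (by simp [Polynomial.monomial_mul_monomial]) hp R hS e
      -- Natural exponents `r` are nonnegative, so exceeding the largest element of `F` is enough.
      (fun F => ⟨F.sup id + 1, fun r _ s hs => by
        have := Finset.le_sup (f := id) hs
        simp only [id] at this
        omega⟩)
    simp only [Polynomial.coe_basisMonomials, Polynomial.monomial_one_right_eq_X_pow,
      ← pow_mul] at h
    exact h
  · have hT : ∀ r : ℤ, AddMonoidAlgebra.basis ℤ k r = (LaurentPolynomial.T r : k[T;T⁻¹]) :=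
      fun r => AddMonoidAlgebra.basis_apply k r
    have h := LieSuperalgebra.freelyGeneratedBy_tensor_envCenter (a := AddMonoidAlgebra.basis ℤ k)
      (fun r s => by rw [hT, hT, hT, LaurentPolynomial.T_add]) hp R hS e
      -- With `M = ∑ |r|` all exponents lie in `[-M, M]`, so a shift by `2M + 1` carries each of
      -- them above `M`.
      (fun F => ⟨2 * ∑ r ∈ F, |r| + 1, fun r hr s hs => by
        have h1 := Finset.single_le_sum (f := fun r : ℤ => |r|) (fun _ _ => abs_nonneg _) hr
        have h2 := Finset.single_le_sum (f := fun r : ℤ => |r|) (fun _ _ => abs_nonneg _) hs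
        have h3 := neg_abs_le r
        have h4 := le_abs_self s
        omega⟩)
    simp only [hT, LaurentPolynomial.T_pow] at h
    simp only [mul_comm (p : ℤ)] at h
    exact h
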